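/- **Setting.** Let $\phi$ be a real-valued smooth function on a neighborhood of the origin in $\mathbb{R}^2$ with $\phi(0,0)=0$ and $\nabla\phi(0,0)=0$, of finite type at the origin, i.e. its Taylor support $\mathcal T(\phi)=\{\alpha\in\mathbb{N}^2:\partial_1^{\alpha_1}\partial_2^{\alpha_2}\phi(0,0)\neq 0\}$ is non-empty (here $0\in\mathbb N$). The Newton polyhedron $\mathcal N(\phi)$ is the convex hull of the union of the quadrants $\alpha+[0,\infty)^2$, $\alpha\in\mathcal T(\phi)$, and the Newton distance $d(\phi)$ is the coordinate $d$ of the point $(d,d)$ at which the bisectrix $t_1=t_2$ meets the boundary of $\mathcal N(\phi)$. The height is $h(\phi)=\sup_\Phi d(\phi\circ\Phi)$, the supremum being over all germs $\Phi$ of smooth local diffeomorphisms of $\mathbb{R}^2$ at the origin with $\Phi(0)=0$; the linear height is $h_{\mathrm{lin}}(\phi)=\sup\{d(\phi\circ T):T\in GL(2,\mathbb{R})\}$. The linear coordinate system $y$ given by $x=Ty$, $T\in GL(2,\mathbb{R})$, is adapted to $\phi$ if $d(\phi\circ T)=h(\phi)$. A function $f$ of one real variable is flat if $f(s)=O(|s|^N)$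 as $s\to0$ for every $N\in\mathbb{N}$. **Proposition 3.1.** Assume that $h_{\mathrm{lin}}(\phi)<2$ and that no linear coordinate system is adapted to $\phi$. Then, after a suitable linear change of coordinates (i.e. after replacing $\phi$ by $\phi\circ T$ for a suitable $T\in GL(2,\mathbb{R})$), one can write, on a sufficiently small neighborhood of the origin, $$\phi(x_1,x_2)=b(x_1,x_2)\,(x_2-\psi(x_1))^2+b_0(x_1),$$ where $b$, $b_0$ and $\psi$ are smooth near the origin and $\psi(x_1)=cx_1^m+O(x_1^{m+1})$ as $x_1\to 0$, with $c\neq0$ and an integer $m\ge2$, in such a way that one of the following two cases holds. * **Type A.** $b(0,0)\neq0$, and either $b_0$ is flat, or $b_0(x_1)=x_1^n\beta(x_1)$ near the origin with $\beta$ smooth, $\beta(0)\neq0$ and an integer $n\ge 2m+1$. * **Type D.** $b(0,0)=0$ and $b(x_1,x_2)=x_1b_1(x_1,x_2)+x_2^2b_2(x_2)$ near the origin with smooth $b_1,b_2$ and $b_1(0,0)\neq0$, and either $b_0$ is flat, or $b_0(x_1)=x_1^n\beta(x_1)$ near the origin with $\beta$ smooth, $\beta(0)\neq0$ and an integer $n\ge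 2m+2$. -/

import Mathlib

open Filter Topology Asymptotics
open scoped ContDiff ENNReal NNReal

/-- `f` is smooth (infinitely differentiable) on some neighbourhood of the origin. -/
def SmoothNearZero {E F : Type*} [NormedAddCommGroup E] [NormedSpace ℝ E]
    [NormedAddCommGroup F] [NormedSpace ℝ F] (f : E → F) : Prop :=
  ∃ U : Set E, IsOpen U ∧ (0 : E) ∈ U ∧ ContDiffOn ℝ ∞ f U

/-- The function `f` of one real variable is flat at the origin:
`f(x) = O(|x|^N)` as `x → 0`, for every `N`. -/
def IsFlatAtZero (f : ℝ → ℝ) : Prop :=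
  ∀ N : ℕ, f =O[𝓝 0] fun x => |x| ^ N

/-- The Taylor coefficient `c_α = (1 / (α₁! α₂!)) ∂₁^α₁ ∂₂^α₂ φ (0, 0)`. -/
noncomputable def taylorCoefficient (φ : ℝ × ℝ → ℝ) (α : ℕ × ℕ) : ℝ :=
  iteratedDeriv α.1 (fun x₁ => iteratedDeriv α.2 (fun x₂ => φ (x₁, x₂)) 0) 0 /
    ((α.1.factorial : ℝ) * (α.2.factorial : ℝ))

/-- The Taylor support of `φ` at the origin. -/
def taylorSupport (φ : ℝ × ℝ → ℝ) : Set (ℕ × ℕ) :=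
  {α | taylorCoefficient φ α ≠ 0}

/-- The Newton polyhedron of `φ` at the origin: the convex hull of the union of the quadrants
`α + [0, ∞)²`, where `α` runs through the Taylor support. -/
def newtonPolyhedron (φ : ℝ × ℝ → ℝ) : Set (ℝ × ℝ) :=
  convexHull ℝ (⋃ α ∈ taylorSupport φ, {t : ℝ × ℝ | (α.1 : ℝ) ≤ t.1 ∧ (α.2 : ℝ) ≤ t.2})

/-- The Newton distance: the coordinate `d` of the point `(d, d)` where the bisectrix `t₁ = t₂`
meets the boundary of the Newton polyhedron. The polyhedron is contained in `[0, ∞)²` and is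
stable under adding vectors of `[0, ∞)²`, so `(d, d)` is the point where the bisectrix enters
it. The value is `∞` exactly if the polyhedron is empty. -/
noncomputable def newtonDistance (φ : ℝ × ℝ → ℝ) : ℝ≥0∞ :=
  ⨅ (t : ℝ≥0) (_ : ((t : ℝ), (t : ℝ)) ∈ newtonPolyhedron φ), (t : ℝ≥0∞)

/-- `Φ` expresses the original coordinates `x = Φ(y)` through a smooth local coordinate system
`y` at the origin which preserves the origin, i.e. `Φ` is smooth near `0`, fixes `0`, and its
derivative at `0` is invertible. -/
def IsLocalCoordinateChange (Φ : ℝ × ℝ → ℝ × ℝ) : Prop :=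
  SmoothNearZero Φ ∧ Φ 0 = 0 ∧ Function.Bijective (fderiv ℝ Φ 0)

/-- The height of `φ`: the supremum of the Newton distances of `φ` in all smooth local coordinate
systems at the origin. -/
noncomputable def height (φ : ℝ × ℝ → ℝ) : ℝ≥0∞ :=
  ⨆ (Φ : ℝ × ℝ → ℝ × ℝ) (_ : IsLocalCoordinateChange Φ), newtonDistance (φ ∘ Φ)

/-- The linear height of `φ`: the supremum of the Newton distances of `φ` in all linear
coordinate systems. -/
noncomputable def linearHeight (φ : ℝ × ℝ → ℝ) : ℝ≥0∞ :=
  ⨆ T : (ℝ × ℝ) ≃L[ℝ] (ℝ × ℝ), newtonDistance (φ ∘ T)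

/-- The linear coordinates `y` given by `x = T y` are adapted to `φ`: the Newton distance of `φ`
in these coordinates equals the height of `φ`. -/
def LinearCoordinatesAdapted (φ : ℝ × ℝ → ℝ) (T : (ℝ × ℝ) ≃L[ℝ] (ℝ × ℝ)) : Prop :=
  newtonDistance (φ ∘ T) = height φ

/-- `f` is flat at the origin, or `f(x) = x^n β(x)` near the origin for some `n ≥ k` and some
smooth `β` with `β(0) ≠ 0`. -/
def IsFlatOrHasOrderAtLeast (f : ℝ → ℝ) (k : ℕ) : Prop :=
  IsFlatAtZero f ∨
    ∃ (n : ℕ) (β : ℝ → ℝ), k ≤ n ∧ SmoothNearZero β ∧ β 0 ≠ 0 ∧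
      ∀ᶠ x in 𝓝 (0 : ℝ), f x = x ^ n * β x

/-! ### Smooth functions near the origin -/

/-! Linear coordinates fail to be adapted exactly when some smooth change of coordinates strictly
raises the Newton distance d. Lower bounds for d come from weights: if all Taylor monomials have
weighted degree at least S, then d ≥ S/(v + w) (`le_newtonDistance`). Upper bounds come from two
support points on opposite sides of the bisectrix and under the line v t₁ + w t₂ = S
(`newtonDistance_le`). Whenever such an upper bound persists in all coordinates and equals the lower
bound in the given ones, these are adapted, a contradiction.

The lowest homogeneous part is transformed only by the linear part of a coordinate change
(`WeightedOrderGE.comp`). If no square of a linear form divides it, d is half its degree in all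
coordinates; so some linear change makes it divisible by x₂² (`exists_linear_coefficients_eq_zero`).
A quadratic part a x₂² with a ≠ 0 leads to type A. If the quadratic part vanishes, the cubic part
becomes x₂²(p x₁ + q x₂). Here p = q = 0 gives d ≥ 2, against the bound on the linear height; p = 0
≠ q is the situation of E₆, E₇, E₈, where the coordinates are adapted or d ≥ 2
(`newtonDistance_comp_le_of_cube`); p ≠ 0 becomes p x₁x₂² by a shear and leads to type D.

In the two surviving cases the lowest part is a x₁^l x₂², with l = 0 for A and l = 1 for D. Solving
∂₂φ = 0 by x₂ = ψ(x₁) and expanding about this curve completes the square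
(`exists_square_completion`). Let m and n be the orders of ψ and b₀, possibly infinite. If n is
finite and n ≤ 2m + l, the weights (2, n − l) give d ≥ 2n/(2 + n − l), and no coordinates do better
(`newtonDistance_comp_le_of_normalForm`), a contradiction. If both are infinite, φ is formally
divisible by x₂², so d ≥ 2. There remains m finite with b₀ flat or n ≥ 2m + 1 + l
(`exists_normalForm`). -/

lemma SmoothNearZero.of_contDiff {E F : Type*} [NormedAddCommGroup E] [NormedSpace ℝ E]
    [NormedAddCommGroup F] [NormedSpace ℝ F] {f : E → F} (hf : ContDiff ℝ ∞ f) :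
    SmoothNearZero f :=
  ⟨Set.univ, isOpen_univ, Set.mem_univ _, hf.contDiffOn⟩

/-- Multiplication by a bump function supported in the domain of smoothness does not change the
germ. Newton data depend only on the germ, so later arguments can assume global smoothness. -/
lemma SmoothNearZero.exists_contDiff {E F : Type*} [NormedAddCommGroup E] [NormedSpace ℝ E]
    [FiniteDimensional ℝ E] [NormedAddCommGroup F] [NormedSpace ℝ F] {f : E → F}
    (hf : SmoothNearZero f) : ∃ g : E → F, ContDiff ℝ ∞ g ∧ f =ᶠ[𝓝 0] g := by
  obtain ⟨U, hU, h0, hfU⟩ := hf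
  obtain ⟨r, hr, hrU⟩ := Metric.isOpen_iff.1 hU 0 h0
  let χ : ContDiffBump (0 : E) := ⟨r / 4, r / 2, by positivity, by linarith⟩
  refine ⟨fun x => χ x • f x, ?_, ?_⟩
  · rw [contDiff_iff_contDiffAt]
    intro x
    by_cases hx : x ∈ tsupport χ
    · rw [χ.tsupport_eq] at hx
      have hxU : x ∈ U := hrU (Metric.closedBall_subset_ball (by simp [χ]; linarith) hx)
      exact χ.contDiffAt.smul (hfU.contDiffAt (hU.mem_nhds hxU))
    · have : (fun x => χ x • f x) =ᶠ[𝓝 x] fun _ => 0 := by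
        filter_upwards [notMem_tsupport_iff_eventuallyEq.1 hx] with y hy
        simp [hy]
      exact contDiffAt_const.congr_of_eventuallyEq this
  · filter_upwards [χ.eventuallyEq_one] with x hx
    simp [hx]

/-- Differentiation under the integral sign produces an integral of the same kind with values in `E
→L[ℝ] F`, so the induction has to range over all targets `F`. -/
lemma contDiff_nat_intervalIntegral {E : Type} [NormedAddCommGroup E] [NormedSpace ℝ E]
    [FiniteDimensional ℝ E] (n : ℕ) :
    ∀ {F : Type} [NormedAddCommGroup F] [NormedSpace ℝ F] [CompleteSpace F] {f : E × ℝ → F},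
      ContDiff ℝ ∞ f → ContDiff ℝ n fun x => ∫ t in (0 : ℝ)..1, f (x, t) := by
  induction n with
  | zero =>
    intro F _ _ _ f hf
    rw [Nat.cast_zero, contDiff_zero]
    exact intervalIntegral.continuous_parametric_intervalIntegral_of_continuous'
      (f := fun x t => f (x, t)) (by simpa [Function.uncurry_def] using hf.continuous) 0 1
  | succ n ih =>
    intro F _ _ _ f hf
    let f' : E × ℝ → E →L[ℝ] F := fun p => (fderiv ℝ f p).comp (ContinuousLinearMap.inl ℝ E ℝ)
    have hf' : ContDiff ℝ ∞ f' :=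
      (hf.fderiv_right (m := ∞) le_rfl).clm_comp contDiff_const
    have hder : ∀ x, HasFDerivAt (fun x => ∫ t in (0 : ℝ)..1, f (x, t))
        (∫ t in (0 : ℝ)..1, f' (x, t)) x := by
      intro x
      have hK : IsCompact (Metric.closedBall x 1 ×ˢ Set.Icc (0 : ℝ) 1) :=
        (isCompact_closedBall x 1).prod isCompact_Icc
      obtain ⟨C, hC⟩ := hK.exists_bound_of_continuousOn hf'.continuous.continuousOn
      have hslice : ∀ y, Continuous fun t : ℝ => f (y, t) := fun y =>
        hf.continuous.comp (by fun_prop)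
      refine intervalIntegral.hasFDerivAt_integral_of_dominated_of_fderiv_le
        (F := fun x t => f (x, t)) (F' := fun x t => f' (x, t)) (bound := fun _ => C)
        (Metric.closedBall_mem_nhds x one_pos)
        (Eventually.of_forall fun y => (hslice y).aestronglyMeasurable)
        ((hslice x).intervalIntegrable _ _) ?_ ?_ intervalIntegrable_const ?_
      · exact (hf'.continuous.comp (by fun_prop : Continuous fun t : ℝ => (x, t)))
          |>.aestronglyMeasurable
      · refine Eventually.of_forall fun t ht y hy => hC (y, t) ⟨hy, ?_⟩
        rw [Set.uIoc_of_le zero_le_one] at ht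
        exact ⟨ht.1.le, ht.2⟩
      · refine Eventually.of_forall fun t _ y _ => ?_
        exact ((hf.differentiable (by simp)) (y, t)).hasFDerivAt.comp y
          (hasFDerivAt_prodMk_left y t)
    have : ((n + 1 : ℕ) : WithTop ℕ∞) = (n : WithTop ℕ∞) + 1 := by push_cast; rfl
    rw [this, contDiff_succ_iff_hasFDerivAt]
    exact ⟨_, ih hf', hder⟩

/-- Integrals over a compact interval depend smoothly on parameters. -/
lemma contDiff_intervalIntegral {E F : Type} [NormedAddCommGroup E] [NormedSpace ℝ E]
    [FiniteDimensional ℝ E] [NormedAddCommGroup F] [NormedSpace ℝ F] [CompleteSpace F]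
    {f : E × ℝ → F} (hf : ContDiff ℝ ∞ f) :
    ContDiff ℝ ∞ fun x => ∫ t in (0 : ℝ)..1, f (x, t) :=
  contDiff_infty.2 fun n => contDiff_nat_intervalIntegral n hf

/-- Hadamard's lemma with a parameter. -/
lemma exists_eq_add_snd_mul {f : ℝ × ℝ → ℝ} (hf : ContDiff ℝ ∞ f) :
    ∃ g : ℝ × ℝ → ℝ, ContDiff ℝ ∞ g ∧ ∀ x y, f (x, y) = f (x, 0) + y * g (x, y) := by
  let D : ℝ × ℝ → ℝ := fun p => fderiv ℝ f p (0, 1)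
  have hD : ContDiff ℝ ∞ D := (hf.fderiv_right (m := ∞) le_rfl).clm_apply contDiff_const
  refine ⟨fun p => ∫ t in (0 : ℝ)..1, D (p.1, t * p.2),
    contDiff_intervalIntegral (f := fun q : (ℝ × ℝ) × ℝ => D (q.1.1, q.2 * q.1.2))
      (hD.comp (by fun_prop)), fun x y => ?_⟩
  have hder : ∀ t : ℝ, HasDerivAt (fun t : ℝ => f (x, t * y)) (y * D (x, t * y)) t := by
    intro t
    have h1 : HasDerivAt (fun t : ℝ => (x, t * y)) ((0 : ℝ), y) t :=
      (hasDerivAt_const t x).prodMk (by simpa using (hasDerivAt_id t).mul_const y)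
    have h2 := ((hf.differentiable (by simp)) (x, t * y)).hasFDerivAt.comp_hasDerivAt t h1
    have h3 : ((0 : ℝ), y) = y • ((0 : ℝ), (1 : ℝ)) := by simp
    rw [h3, map_smul] at h2
    exact h2
  have hcont : Continuous fun t : ℝ => y * D (x, t * y) :=
    continuous_const.mul (hD.continuous.comp (by fun_prop))
  have := intervalIntegral.integral_eq_sub_of_hasDerivAt (a := 0) (b := 1)
    (fun t _ => hder t) (hcont.intervalIntegrable _ _)
  rw [intervalIntegral.integral_const_mul] at this
  simp only [one_mul, zero_mul] at this
  linarith

lemma exists_eq_add_fst_mul {f : ℝ × ℝ → ℝ} (hf : ContDiff ℝ ∞ f) :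
    ∃ g : ℝ × ℝ → ℝ, ContDiff ℝ ∞ g ∧ ∀ x y, f (x, y) = f (0, y) + x * g (x, y) := by
  obtain ⟨g, hg, h⟩ := exists_eq_add_snd_mul (f := fun p => f (p.2, p.1)) (hf.comp (by fun_prop))
  exact ⟨fun p => g (p.2, p.1), hg.comp (by fun_prop), fun x y => h y x⟩

lemma exists_eq_add_mul {f : ℝ → ℝ} (hf : ContDiff ℝ ∞ f) :
    ∃ g : ℝ → ℝ, ContDiff ℝ ∞ g ∧ ∀ x, f x = f 0 + x * g x := by
  obtain ⟨g, hg, h⟩ := exists_eq_add_snd_mul (f := fun p => f p.2) (hf.comp (by fun_prop))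
  exact ⟨fun x => g (0, x), hg.comp (by fun_prop), fun x => h 0 x⟩

/-- The smooth implicit function theorem in the plane, for a zero set that is a graph over the
first axis. -/
lemma exists_smooth_implicit {G : ℝ × ℝ → ℝ} (hG : ContDiff ℝ ∞ G) (h0 : G 0 = 0)
    (h1 : fderiv ℝ G 0 (0, 1) ≠ 0) :
    ∃ η : ℝ → ℝ, ContDiff ℝ ∞ η ∧ η 0 = 0 ∧ ∀ᶠ x in 𝓝 (0 : ℝ), G (x, η x) = 0 := by
  have hinv : ∀ u : ℝ × ℝ, fderiv ℝ G u (0, 1) ≠ 0 →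
      (fderiv ℝ G u ∘L .inr ℝ ℝ ℝ).IsInvertible := by
    intro u hu
    refine ⟨ContinuousLinearEquiv.unitsEquivAut ℝ (Units.mk0 _ hu), ?_⟩
    ext
    simp
  have hne : (∞ : WithTop ℕ∞) ≠ 0 := by simp
  have hD : Continuous fun u => fderiv ℝ G u (0, 1) :=
    ((hG.fderiv_right (m := ∞) le_rfl).clm_apply contDiff_const).continuous
  set η := hG.contDiffAt.implicitFunction hne (hinv 0 h1) with hη
  have hη0 : η 0 = 0 := hG.contDiffAt.implicitFunction_apply_self hne (hinv 0 h1)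
  have hsm : ContDiffAt ℝ ∞ η 0 := hG.contDiffAt.contDiffAt_implicitFunction hne (hinv 0 h1)
  have hGη : ∀ᶠ x in 𝓝 (0 : ℝ), G (x, η x) = 0 := by
    filter_upwards [hG.contDiffAt.eventually_apply_implicitFunction hne (hinv 0 h1)] with x hx
    rw [hx, h0]
  have hcont : ∀ᶠ x in 𝓝 (0 : ℝ), ContinuousAt η x := by
    filter_upwards [(hsm.of_le (m := 1) (by exact_mod_cast le_top)).eventually (by simp)] with x hx
    exact hx.continuousAt
  have hpt : ∀ᶠ x in 𝓝 (0 : ℝ), fderiv ℝ G (x, η x) (0, 1) ≠ 0 := by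
    have hc : ContinuousAt (fun x => fderiv ℝ G (x, η x) (0, 1)) 0 :=
      hD.continuousAt.comp (continuousAt_id.prodMk hsm.continuousAt)
    refine hc.eventually_ne ?_
    rw [hη0]
    exact h1
  -- `ContDiffAt ℝ ∞` at one point only gives neighbourhoods that may shrink with the order.
  -- Smoothness on a full neighbourhood follows by applying the theorem again at nearby points of
  -- the curve and using local uniqueness.
  have hall : ∀ᶠ x in 𝓝 (0 : ℝ), ContDiffAt ℝ ∞ η x := by
    filter_upwards [hGη.eventually_nhds, hcont, hpt] with x hx hcx hdx
    set v : ℝ × ℝ := (x, η x) with hv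
    have hsx : ContDiffAt ℝ ∞ (hG.contDiffAt.implicitFunction hne (hinv v hdx)) x :=
      hG.contDiffAt.contDiffAt_implicitFunction hne (hinv v hdx)
    refine hsx.congr_of_eventuallyEq ?_
    have ht : Tendsto (fun y => (y, η y)) (𝓝 x) (𝓝 v) :=
      (continuousAt_id.prodMk hcx : ContinuousAt (fun y => (y, η y)) x)
    filter_upwards [hx, ht.eventually
      (hG.contDiffAt.eventually_apply_eq_iff_implicitFunction hne (hinv v hdx))] with y hy hy'
    exact (hy'.1 (by rw [hy, hv, hx.self_of_nhds])).symm
  obtain ⟨U, hU, hUo, hU0⟩ := eventually_nhds_iff.1 hall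
  obtain ⟨η', hη', hE⟩ := SmoothNearZero.exists_contDiff (f := η)
    ⟨U, hUo, hU0, fun x hx => (hU x hx).contDiffWithinAt⟩
  refine ⟨η', hη', by rw [← hE.self_of_nhds, hη0], ?_⟩
  filter_upwards [hGη, hE] with x hx hx'
  rw [← hx', hx]

/-! ### Taylor coefficients in one variable -/

/-- The Taylor coefficient of order `k` at the origin of a function of one variable. -/
noncomputable def taylorCoeff (f : ℝ → ℝ) (k : ℕ) : ℝ := iteratedDeriv k f 0 / k.factorial

@[simp] lemma taylorCoeff_zero (f : ℝ → ℝ) : taylorCoeff f 0 = f 0 := by simp [taylorCoeff]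

lemma taylorCoeff_one (f : ℝ → ℝ) : taylorCoeff f 1 = deriv f 0 := by simp [taylorCoeff]

lemma taylorCoeff_congr {f g : ℝ → ℝ} (h : f =ᶠ[𝓝 0] g) (k : ℕ) :
    taylorCoeff f k = taylorCoeff g k := by
  rw [taylorCoeff, taylorCoeff, h.iteratedDeriv_eq]

lemma taylorCoeff_add {f g : ℝ → ℝ} (hf : ContDiff ℝ ∞ f) (hg : ContDiff ℝ ∞ g) (k : ℕ) :
    taylorCoeff (fun x => f x + g x) k = taylorCoeff f k + taylorCoeff g k := by
  have := iteratedDeriv_fun_add (n := k) (x := (0 : ℝ)) (f := f) (g := g)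
    (hf.contDiffAt.of_le (by exact_mod_cast le_top)) (hg.contDiffAt.of_le (by exact_mod_cast le_top))
  rw [taylorCoeff, this, add_div]; rfl

lemma taylorCoeff_sum {ι : Type*} (s : Finset ι) {f : ι → ℝ → ℝ}
    (hf : ∀ i ∈ s, ContDiff ℝ ∞ (f i)) (k : ℕ) :
    taylorCoeff (fun x => ∑ i ∈ s, f i x) k = ∑ i ∈ s, taylorCoeff (f i) k := by
  have := iteratedDeriv_fun_sum (n := k) (x := (0 : ℝ)) (I := s) (f := f)
    (fun i hi => (hf i hi).contDiffAt.of_le (by exact_mod_cast le_top))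
  rw [taylorCoeff, this, Finset.sum_div]; rfl

lemma taylorCoeff_mul {f g : ℝ → ℝ} (hf : ContDiff ℝ ∞ f) (hg : ContDiff ℝ ∞ g) (k : ℕ) :
    taylorCoeff (fun x => f x * g x) k =
      ∑ p ∈ Finset.HasAntidiagonal.antidiagonal k, taylorCoeff f p.1 * taylorCoeff g p.2 := by
  have := iteratedDeriv_fun_mul (n := k) (x := (0 : ℝ)) (f := f) (g := g)
    (hf.contDiffAt.of_le (by exact_mod_cast le_top)) (hg.contDiffAt.of_le (by exact_mod_cast le_top))
  rw [taylorCoeff, this, Finset.Nat.sum_antidiagonal_eq_sum_range_succ_mk, Finset.sum_div]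
  refine Finset.sum_congr rfl fun i hi => ?_
  have hik : i ≤ k := Nat.lt_succ_iff.1 (Finset.mem_range.1 hi)
  rw [Nat.cast_choose ℝ hik, taylorCoeff, taylorCoeff]
  have := Nat.factorial_ne_zero i
  have := Nat.factorial_ne_zero (k - i)
  have := Nat.factorial_ne_zero k
  field_simp

lemma taylorCoeff_const_mul {f : ℝ → ℝ} (c : ℝ) (k : ℕ) :
    taylorCoeff (fun x => c * f x) k = c * taylorCoeff f k := by
  rw [taylorCoeff, iteratedDeriv_const_mul_field, taylorCoeff, mul_div_assoc]

lemma taylorCoeff_const_succ (c : ℝ) (k : ℕ) : taylorCoeff (fun _ => c) (k + 1) = 0 := by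
  simp [taylorCoeff, iteratedDeriv_const]

lemma taylorCoeff_id (k : ℕ) : taylorCoeff (fun x => x) k = if k = 1 then 1 else 0 := by
  rw [taylorCoeff, iteratedDeriv_fun_id_zero]
  split_ifs with h <;> simp [h]

lemma taylorCoeff_mul_succ {u : ℝ → ℝ} (hu : ContDiff ℝ ∞ u) (k : ℕ) :
    taylorCoeff (fun x => x * u x) (k + 1) = taylorCoeff u k := by
  rw [taylorCoeff_mul (f := fun x => x) contDiff_id hu, Finset.Nat.sum_antidiagonal_succ]
  have h : ∀ p : ℕ × ℕ, taylorCoeff (fun x => x) (p.1 + 1) * taylorCoeff u p.2 =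
      if p.1 = 0 then taylorCoeff u p.2 else 0 := by
    intro p
    rw [taylorCoeff_id]
    split_ifs <;> simp_all
  simp only [taylorCoeff_zero, zero_mul, zero_add, h]
  rw [Finset.sum_eq_single (0, k)]
  · simp
  · rintro ⟨a, b⟩ hp hne
    rw [Finset.HasAntidiagonal.mem_antidiagonal] at hp
    refine if_neg fun h0 => hne ?_
    simp only at h0 hp
    rw [Prod.mk.injEq]
    omega
  · simp

lemma taylorCoeff_eq_of_eq_add_mul {f u : ℝ → ℝ} (hu : ContDiff ℝ ∞ u) {c : ℝ}
    (h : ∀ x, f x = c + x * u x) (k : ℕ) : taylorCoeff f (k + 1) = taylorCoeff u k := by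
  have : f = fun x => c + x * u x := funext h
  rw [this, taylorCoeff_add (f := fun _ => c) (g := fun x => x * u x) contDiff_const
    (contDiff_id.mul hu), taylorCoeff_const_succ, zero_add, taylorCoeff_mul_succ hu]

lemma taylorCoeff_pow_mul {u : ℝ → ℝ} (hu : ContDiff ℝ ∞ u) (k : ℕ) :
    taylorCoeff (fun x => x ^ k * u x) k = u 0 := by
  induction k with
  | zero => simp
  | succ k ih =>
    have : (fun x => x ^ (k + 1) * u x) = fun x => x * (x ^ k * u x) := by ext x; ring
    rw [this, taylorCoeff_mul_succ (by fun_prop), ih]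

lemma taylorCoeff_pow_mul_of_lt {u : ℝ → ℝ} (hu : ContDiff ℝ ∞ u) {j k : ℕ} (hj : j < k) :
    taylorCoeff (fun x => x ^ k * u x) j = 0 := by
  obtain ⟨i, rfl⟩ := Nat.exists_eq_add_of_lt hj
  have : (fun x => x ^ (j + i + 1) * u x) = fun x => x ^ j * (x ^ (i + 1) * u x) := by ext x; ring
  rw [this, taylorCoeff_pow_mul (by fun_prop)]
  simp

/-- Hadamard's lemma splits off one factor `x` for each vanishing coefficient. -/
lemma exists_eq_pow_mul {f : ℝ → ℝ} (hf : ContDiff ℝ ∞ f) {k : ℕ}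
    (h : ∀ j < k, taylorCoeff f j = 0) :
    ∃ u : ℝ → ℝ, ContDiff ℝ ∞ u ∧ (∀ x, f x = x ^ k * u x) ∧ u 0 = taylorCoeff f k := by
  induction k with
  | zero => exact ⟨f, hf, by simp, by simp⟩
  | succ k ih =>
    obtain ⟨u, hu, hfu, hu0⟩ := ih fun j hj => h j (by omega)
    obtain ⟨v, hv, huv⟩ := exists_eq_add_mul hu
    have hfv : ∀ x, f x = x ^ (k + 1) * v x := by
      intro x
      rw [hfu, huv, hu0, h k (by omega)]
      ring
    exact ⟨v, hv, hfv, by rw [funext hfv, taylorCoeff_pow_mul hv]⟩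

/-- Either `f` has finite order of vanishing below `N`, or it is divisible by `x ^ N`. -/
lemma exists_order_lt_or_eq_pow_mul {f : ℝ → ℝ} (hf : ContDiff ℝ ∞ f) (N : ℕ) :
    (∃ (k : ℕ) (u : ℝ → ℝ), k < N ∧ ContDiff ℝ ∞ u ∧ u 0 ≠ 0 ∧ ∀ x, f x = x ^ k * u x) ∨
      ∃ u : ℝ → ℝ, ContDiff ℝ ∞ u ∧ ∀ x, f x = x ^ N * u x := by
  classical
  by_cases h : ∃ k, k < N ∧ taylorCoeff f k ≠ 0
  · left
    have h1 := Nat.find_spec h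
    obtain ⟨u, hu, hfu, hu0⟩ := exists_eq_pow_mul hf (k := Nat.find h) fun j hj => by
      have := Nat.find_min h hj
      by_contra hne
      exact this ⟨hj.trans h1.1, hne⟩
    exact ⟨_, u, h1.1, hu, hu0 ▸ h1.2, hfu⟩
  · right
    push Not at h
    obtain ⟨u, hu, hfu, -⟩ := exists_eq_pow_mul hf h
    exact ⟨u, hu, hfu⟩

/-- A smooth function has a finite order of vanishing, or all its Taylor coefficients vanish. -/
lemma exists_order_or_taylorCoeff_eq_zero {f : ℝ → ℝ} (hf : ContDiff ℝ ∞ f) :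
    (∃ (k : ℕ) (u : ℝ → ℝ), ContDiff ℝ ∞ u ∧ u 0 ≠ 0 ∧ ∀ x, f x = x ^ k * u x) ∨
      ∀ k, taylorCoeff f k = 0 := by
  by_cases h : ∀ k, taylorCoeff f k = 0
  · exact Or.inr h
  · push Not at h
    obtain ⟨N, hN⟩ := h
    rcases exists_order_lt_or_eq_pow_mul hf (N + 1) with ⟨k, u, -, h1⟩ | ⟨u, hu, h⟩
    · exact Or.inl ⟨k, u, h1⟩
    · rw [funext h, taylorCoeff_pow_mul_of_lt hu (Nat.lt_succ_self N)] at hN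
      exact absurd rfl hN

lemma isFlatAtZero_of_taylorCoeff_eq_zero {f : ℝ → ℝ} (hf : ContDiff ℝ ∞ f)
    (h : ∀ k, taylorCoeff f k = 0) : IsFlatAtZero f := by
  intro N
  obtain ⟨u, hu, hfu, -⟩ := exists_eq_pow_mul hf (k := N) fun j _ => h j
  have h1 : (fun x : ℝ => x ^ N * u x) =O[𝓝 0] fun x : ℝ => |x| ^ N * 1 := by
    refine IsBigO.mul (IsBigO.of_bound 1 (Eventually.of_forall fun x => by simp)) ?_
    exact hu.continuous.continuousAt.isBigO_one ℝ
  simpa [← funext hfu] using h1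

/-! ### Taylor coefficients in two variables -/

/-- The coefficient of `x₂ ^ j` in the Taylor expansion of `f (x₁, ·)` at the origin. -/
noncomputable def sliceCoeff (f : ℝ × ℝ → ℝ) (j : ℕ) (x : ℝ) : ℝ :=
  taylorCoeff (fun y => f (x, y)) j

lemma taylorCoefficient_eq (f : ℝ × ℝ → ℝ) (α : ℕ × ℕ) :
    taylorCoefficient f α = taylorCoeff (sliceCoeff f α.2) α.1 := by
  have : sliceCoeff f α.2 = fun x =>
      (α.2.factorial : ℝ)⁻¹ * iteratedDeriv α.2 (fun y => f (x, y)) 0 := by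
    ext x; rw [sliceCoeff, taylorCoeff, div_eq_inv_mul]
  rw [this, taylorCoeff_const_mul, taylorCoefficient, taylorCoeff]
  field_simp

lemma taylorCoefficient_congr {f g : ℝ × ℝ → ℝ} (h : f =ᶠ[𝓝 0] g) (α : ℕ × ℕ) :
    taylorCoefficient f α = taylorCoefficient g α := by
  rw [taylorCoefficient_eq, taylorCoefficient_eq]
  refine taylorCoeff_congr ?_ _
  have h' : ∀ᶠ p in 𝓝 ((0 : ℝ), (0 : ℝ)), f p = g p := h
  filter_upwards [h'.curry_nhds] with x hx
  exact taylorCoeff_congr hx _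

lemma sliceCoeff_of_eq_add_mul {f h : ℝ × ℝ → ℝ} (hh : ContDiff ℝ ∞ h) {a : ℝ → ℝ}
    (hf : ∀ x y, f (x, y) = a x + y * h (x, y)) (j : ℕ) :
    sliceCoeff f (j + 1) = sliceCoeff h j := by
  ext x
  exact taylorCoeff_eq_of_eq_add_mul (hh.comp (by fun_prop)) (hf x) j

/-- Dividing by x₂ lowers the index by one, which reduces the claim to the restriction to the first
axis. -/
lemma contDiff_sliceCoeff {f : ℝ × ℝ → ℝ} (hf : ContDiff ℝ ∞ f) (j : ℕ) :
    ContDiff ℝ ∞ (sliceCoeff f j) := by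
  induction j generalizing f with
  | zero =>
    have : sliceCoeff f 0 = fun x => f (x, 0) := by ext x; simp [sliceCoeff]
    rw [this]
    exact hf.comp (by fun_prop)
  | succ j ih =>
    obtain ⟨h, hh, hfh⟩ := exists_eq_add_snd_mul hf
    rw [sliceCoeff_of_eq_add_mul hh hfh]
    exact ih hh

lemma taylorCoefficient_zero_right (f : ℝ × ℝ → ℝ) (i : ℕ) :
    taylorCoefficient f (i, 0) = taylorCoeff (fun x => f (x, 0)) i := by
  rw [taylorCoefficient_eq]
  congr 1
  ext x
  exact taylorCoeff_zero _

lemma taylorCoefficient_zero_left (f : ℝ × ℝ → ℝ) (j : ℕ) :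
    taylorCoefficient f (0, j) = taylorCoeff (fun y => f (0, y)) j := by
  rw [taylorCoefficient_eq, taylorCoeff_zero, sliceCoeff]

lemma taylorCoefficient_one_right (f : ℝ × ℝ → ℝ) (i : ℕ) :
    taylorCoefficient f (i, 1) = taylorCoeff (fun x => deriv (fun y => f (x, y)) 0) i := by
  rw [taylorCoefficient_eq]
  congr 1
  ext x
  exact taylorCoeff_one _

@[simp] lemma taylorCoefficient_zero (f : ℝ × ℝ → ℝ) : taylorCoefficient f (0, 0) = f 0 := by
  rw [taylorCoefficient_zero_left, taylorCoeff_zero]; rfl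

lemma taylorCoefficient_snd_succ {f h : ℝ × ℝ → ℝ} (hh : ContDiff ℝ ∞ h) {a : ℝ → ℝ}
    (hf : ∀ x y, f (x, y) = a x + y * h (x, y)) (i j : ℕ) :
    taylorCoefficient f (i, j + 1) = taylorCoefficient h (i, j) := by
  rw [taylorCoefficient_eq, taylorCoefficient_eq, sliceCoeff_of_eq_add_mul hh hf]

lemma taylorCoefficient_fst_succ {f h : ℝ × ℝ → ℝ} (hh : ContDiff ℝ ∞ h) {a : ℝ → ℝ}
    (ha : ContDiff ℝ ∞ a) (hf : ∀ x y, f (x, y) = a y + x * h (x, y)) (i j : ℕ) :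
    taylorCoefficient f (i + 1, j) = taylorCoefficient h (i, j) := by
  rw [taylorCoefficient_eq, taylorCoefficient_eq]
  refine taylorCoeff_eq_of_eq_add_mul (c := taylorCoeff a j) (contDiff_sliceCoeff hh j)
    (fun x => ?_) i
  rw [sliceCoeff, funext (hf x), taylorCoeff_add (g := fun y => x * h (x, y)) ha
    (contDiff_const.mul (hh.comp (by fun_prop))), taylorCoeff_const_mul, sliceCoeff]

lemma taylorCoefficient_add {f g : ℝ × ℝ → ℝ} (hf : ContDiff ℝ ∞ f) (hg : ContDiff ℝ ∞ g)
    (α : ℕ × ℕ) : taylorCoefficient (fun p => f p + g p) α =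
      taylorCoefficient f α + taylorCoefficient g α := by
  simp only [taylorCoefficient_eq]
  rw [← taylorCoeff_add (contDiff_sliceCoeff hf _) (contDiff_sliceCoeff hg _)]
  congr 1
  ext x
  exact taylorCoeff_add (hf.comp (by fun_prop)) (hg.comp (by fun_prop)) _

lemma taylorCoefficient_mul {f g : ℝ × ℝ → ℝ} (hf : ContDiff ℝ ∞ f) (hg : ContDiff ℝ ∞ g)
    (α : ℕ × ℕ) : taylorCoefficient (fun p => f p * g p) α =
      ∑ q ∈ Finset.HasAntidiagonal.antidiagonal α.2, ∑ p ∈ Finset.HasAntidiagonal.antidiagonal α.1,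
        taylorCoefficient f (p.1, q.1) * taylorCoefficient g (p.2, q.2) := by
  simp only [taylorCoefficient_eq]
  have : sliceCoeff (fun p => f p * g p) α.2 = fun x =>
      ∑ q ∈ Finset.HasAntidiagonal.antidiagonal α.2, sliceCoeff f q.1 x * sliceCoeff g q.2 x := by
    ext x
    exact taylorCoeff_mul (hf.comp (by fun_prop)) (hg.comp (by fun_prop)) _
  rw [this, taylorCoeff_sum]
  · exact Finset.sum_congr rfl fun q _ =>
      taylorCoeff_mul (contDiff_sliceCoeff hf _) (contDiff_sliceCoeff hg _) _
  · exact fun q _ => (contDiff_sliceCoeff hf _).mul (contDiff_sliceCoeff hg _)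

/-- This is the symmetry of mixed partial derivatives, obtained by splitting off factors x₁ with
Hadamard's lemma. -/
lemma taylorCoefficient_comp_swap {f : ℝ × ℝ → ℝ} (hf : ContDiff ℝ ∞ f) (i j : ℕ) :
    taylorCoefficient (f ∘ Prod.swap) (j, i) = taylorCoefficient f (i, j) := by
  induction i generalizing f with
  | zero => rw [taylorCoefficient_zero_right, taylorCoefficient_zero_left]; rfl
  | succ i ih =>
    obtain ⟨h, hh, hfh⟩ := exists_eq_add_fst_mul hf
    rw [taylorCoefficient_fst_succ hh (a := fun y => f (0, y)) (hf.comp (by fun_prop)) hfh, ← ih hh]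
    exact taylorCoefficient_snd_succ (hh.comp (contDiff_snd.prodMk contDiff_fst)) (a := fun x => f (0, x))
      (fun x y => hfh y x) j i

/-! ### Weighted orders of vanishing and homogeneous parts -/

/-- All monomials `x₁ ^ i * x₂ ^ j` in the Taylor series of `f` have weighted degree
`v * i + w * j` at least `S`. -/
def WeightedOrderGE (v w S : ℕ) (f : ℝ × ℝ → ℝ) : Prop :=
  ∀ i j, v * i + w * j < S → taylorCoefficient f (i, j) = 0

lemma WeightedOrderGE.congr {v w S : ℕ} {f g : ℝ × ℝ → ℝ} (hf : WeightedOrderGE v w S f)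
    (h : f =ᶠ[𝓝 0] g) : WeightedOrderGE v w S g := fun i j hij => by
  rw [← taylorCoefficient_congr h, hf i j hij]

lemma WeightedOrderGE.add {v w S : ℕ} {f g : ℝ × ℝ → ℝ} (hf : WeightedOrderGE v w S f)
    (hg : WeightedOrderGE v w S g) (hfs : ContDiff ℝ ∞ f) (hgs : ContDiff ℝ ∞ g) :
    WeightedOrderGE v w S fun p => f p + g p := fun i j hij => by
  rw [taylorCoefficient_add hfs hgs, hf i j hij, hg i j hij, add_zero]

lemma WeightedOrderGE.mul {v w S S' : ℕ} {f g : ℝ × ℝ → ℝ} (hf : WeightedOrderGE v w S f)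
    (hg : WeightedOrderGE v w S' g) (hfs : ContDiff ℝ ∞ f) (hgs : ContDiff ℝ ∞ g) :
    WeightedOrderGE v w (S + S') fun p => f p * g p := fun i j hij => by
  rw [taylorCoefficient_mul hfs hgs]
  refine Finset.sum_eq_zero fun q hq => Finset.sum_eq_zero fun p hp => ?_
  rw [Finset.HasAntidiagonal.mem_antidiagonal] at hq hp
  simp only at hq hp
  by_cases h : v * p.1 + w * q.1 < S
  · rw [hf _ _ h, zero_mul]
  · rw [hg, mul_zero]
    rw [← hq, ← hp, mul_add, mul_add] at hij
    omega

lemma taylorCoefficient_comp_fst (a : ℝ → ℝ) (i j : ℕ) :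
    taylorCoefficient (fun p => a p.1) (i, j) = if j = 0 then taylorCoeff a i else 0 := by
  rcases j with _ | j
  · rw [taylorCoefficient_zero_right]; rfl
  · rw [if_neg (by omega), taylorCoefficient_snd_succ (h := fun _ => 0) contDiff_const (a := a)
      (by simp), taylorCoefficient_eq]
    have : sliceCoeff (fun _ => 0) j = fun _ => 0 := by
      ext x
      rcases j with _ | j
      · exact taylorCoeff_zero _
      · exact taylorCoeff_const_succ 0 j
    rw [this]
    rcases i with _ | i
    · exact taylorCoeff_zero _
    · exact taylorCoeff_const_succ 0 i

/-- The homogeneous part of degree `k` of the Taylor series of `f`. -/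
noncomputable def homogeneousPart (f : ℝ × ℝ → ℝ) (k : ℕ) (y : ℝ × ℝ) : ℝ :=
  ∑ i ∈ Finset.range (k + 1), taylorCoefficient f (i, k - i) * (y.1 ^ i * y.2 ^ (k - i))

/-- Setting the second variable to 1 turns a binary form into a polynomial with the same
coefficients. -/
lemma binaryForm_coeff_eq {k : ℕ} {c d : ℕ → ℝ}
    (h : ∀ y : ℝ × ℝ, ∑ i ∈ Finset.range (k + 1), c i * (y.1 ^ i * y.2 ^ (k - i)) =
      ∑ i ∈ Finset.range (k + 1), d i * (y.1 ^ i * y.2 ^ (k - i))) {i : ℕ} (hi : i ≤ k) :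
    c i = d i := by
  let P : (ℕ → ℝ) → Polynomial ℝ := fun c =>
    ∑ i ∈ Finset.range (k + 1), Polynomial.monomial i (c i)
  have hP : P c = P d := by
    refine Polynomial.funext fun x => ?_
    simpa [P, Polynomial.eval_finsetSum] using h (x, 1)
  have hcoeff : ∀ c, (P c).coeff i = c i := by
    intro c
    simp only [P, Polynomial.finsetSum_coeff, Polynomial.coeff_monomial]
    rw [Finset.sum_ite_eq' _ i c, if_pos (Finset.mem_range.2 (by omega))]
  rw [← hcoeff c, hP, hcoeff]

/-- Induction on the degree: f(x, 0) is divisible by the full power of x, and the remainder is y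
times a function whose order is lower by one. -/
lemma exists_homogeneous_decomposition {f : ℝ × ℝ → ℝ} (hf : ContDiff ℝ ∞ f) {k : ℕ}
    (h : WeightedOrderGE 1 1 k f) :
    ∃ A : ℕ → ℝ × ℝ → ℝ, (∀ i, ContDiff ℝ ∞ (A i)) ∧
      (∀ y : ℝ × ℝ, f y = ∑ i ∈ Finset.range (k + 1), A i y * (y.1 ^ i * y.2 ^ (k - i))) ∧
      ∀ i ≤ k, A i 0 = taylorCoefficient f (i, k - i) := by
  induction k generalizing f with
  | zero => exact ⟨fun _ => f, fun _ => hf, by simp, fun i hi => by simp [Nat.le_zero.1 hi]⟩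
  | succ k ih =>
    obtain ⟨g, hg, hfg⟩ := exists_eq_add_snd_mul hf
    have hcg : ∀ i j, taylorCoefficient f (i, j + 1) = taylorCoefficient g (i, j) :=
      taylorCoefficient_snd_succ hg hfg
    obtain ⟨A, hA, hgA, hA0⟩ := ih hg fun i j hij => by rw [← hcg, h _ _ (by omega)]
    obtain ⟨u, hu, hfu, hu0⟩ := exists_eq_pow_mul (f := fun x => f (x, 0)) (hf.comp (by fun_prop))
      (k := k + 1) fun j hj => by rw [← taylorCoefficient_zero_right, h _ _ (by omega)]
    refine ⟨fun i => if i ≤ k then A i else fun p => u p.1, fun i => ?_, fun y => ?_, fun i hi => ?_⟩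
    · beta_reduce
      split_ifs
      exacts [hA i, hu.comp contDiff_fst]
    · beta_reduce
      rw [Finset.sum_range_succ, if_neg (by omega), Nat.sub_self, pow_zero, mul_one]
      obtain ⟨x, y⟩ := y
      rw [hfg, hgA, hfu, Finset.mul_sum, mul_comm (u _), add_comm]
      congr 1
      refine Finset.sum_congr rfl fun i hi => ?_
      have hi : i ≤ k := Nat.lt_succ_iff.1 (Finset.mem_range.1 hi)
      rw [if_pos hi, Nat.succ_sub hi, pow_succ]
      ring
    · rcases Nat.lt_or_ge k i with hk | hk
      · obtain rfl : i = k + 1 := by omega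
        simp [hu0, taylorCoefficient_zero_right]
      · simp only [if_pos hk]
        rw [hA0 i hk, Nat.succ_sub hk, hcg]

/-- Both components of the curve are divisible by r, so each monomial of degree k in the
decomposition contributes r^k; at r = 0 the quotients are the components of the velocity. -/
lemma exists_comp_curve_eq_pow_mul {f : ℝ × ℝ → ℝ} (hf : ContDiff ℝ ∞ f) {k : ℕ}
    (h : WeightedOrderGE 1 1 k f) {γ : ℝ → ℝ × ℝ} (hγ : ContDiff ℝ ∞ γ) (hγ0 : γ 0 = 0) :
    ∃ u : ℝ → ℝ, ContDiff ℝ ∞ u ∧ (∀ r, f (γ r) = r ^ k * u r) ∧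
      u 0 = homogeneousPart f k (deriv γ 0) := by
  obtain ⟨A, hA, hfA, hA0⟩ := exists_homogeneous_decomposition hf h
  have key : ∀ {g : ℝ → ℝ}, ContDiff ℝ ∞ g → g 0 = 0 →
      ∃ v : ℝ → ℝ, ContDiff ℝ ∞ v ∧ (∀ r, g r = r * v r) ∧ v 0 = deriv g 0 := by
    intro g hg hg0
    obtain ⟨v, hv, hgv⟩ := exists_eq_add_mul hg
    have hgv' : ∀ r, g r = r * v r := fun r => by rw [hgv, hg0, zero_add]
    refine ⟨v, hv, hgv', ?_⟩
    rw [← taylorCoeff_one, funext hgv', taylorCoeff_mul_succ hv 0, taylorCoeff_zero]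
  have hd : HasDerivAt γ (deriv γ 0) 0 := (hγ.differentiable (by simp) 0).hasDerivAt
  obtain ⟨v₁, hv₁, h₁, h₁'⟩ := key (contDiff_fst.comp hγ) (by simp [hγ0])
  obtain ⟨v₂, hv₂, h₂, h₂'⟩ := key (contDiff_snd.comp hγ) (by simp [hγ0])
  have e₁ : v₁ 0 = (deriv γ 0).1 := by
    rw [h₁']
    exact (hasFDerivAt_fst.comp_hasDerivAt (0 : ℝ) hd).deriv
  have e₂ : v₂ 0 = (deriv γ 0).2 := by
    rw [h₂']
    exact (hasFDerivAt_snd.comp_hasDerivAt (0 : ℝ) hd).deriv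
  refine ⟨fun r => ∑ i ∈ Finset.range (k + 1), A i (γ r) * (v₁ r ^ i * v₂ r ^ (k - i)),
    ContDiff.sum fun i _ => ((hA i).comp hγ).mul ((hv₁.pow i).mul (hv₂.pow (k - i))),
    fun r => ?_, ?_⟩
  · rw [hfA, Finset.mul_sum]
    refine Finset.sum_congr rfl fun i hi => ?_
    have hi : i ≤ k := Nat.lt_succ_iff.1 (Finset.mem_range.1 hi)
    have h₁r : (γ r).1 = r * v₁ r := h₁ r
    have h₂r : (γ r).2 = r * v₂ r := h₂ r
    rw [h₁r, h₂r, mul_pow, mul_pow]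
    nth_rewrite 3 [← Nat.add_sub_cancel' hi]
    rw [pow_add]
    ring
  · rw [homogeneousPart]
    refine Finset.sum_congr rfl fun i hi => ?_
    have hi : i ≤ k := Nat.lt_succ_iff.1 (Finset.mem_range.1 hi)
    rw [hγ0, hA0 i hi, e₁, e₂]

/-- Along a ray, f ∘ Φ is r^k times a smooth function whose value at 0 is the k-th form of f at the
image direction. Comparison with the expansion of f ∘ Φ itself kills its forms of degree below k one
after another and identifies the form of degree k. -/
lemma WeightedOrderGE.comp {f : ℝ × ℝ → ℝ} (hf : ContDiff ℝ ∞ f) {k : ℕ}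
    (h : WeightedOrderGE 1 1 k f) {Φ : ℝ × ℝ → ℝ × ℝ} (hΦ : ContDiff ℝ ∞ Φ) (hΦ0 : Φ 0 = 0) :
    WeightedOrderGE 1 1 k (f ∘ Φ) ∧
      ∀ y, homogeneousPart (f ∘ Φ) k y = homogeneousPart f k (fderiv ℝ Φ 0 y) := by
  have hF : ContDiff ℝ ∞ (f ∘ Φ) := hf.comp hΦ
  have hray : ∀ y : ℝ × ℝ, HasDerivAt (fun r : ℝ => r • y) y 0 := fun y => by
    simpa using (hasDerivAt_id (0 : ℝ)).smul_const y
  have main : ∀ j ≤ k, WeightedOrderGE 1 1 j (f ∘ Φ) → ∀ y,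
      homogeneousPart (f ∘ Φ) j y =
        if j = k then homogeneousPart f k (fderiv ℝ Φ 0 y) else 0 := by
    intro j hj hFj y
    obtain ⟨u, hu, hFu, hu0⟩ := exists_comp_curve_eq_pow_mul hF hFj (γ := fun r => r • y)
      (by fun_prop) (by simp)
    obtain ⟨v, hv, hfv, hv0⟩ := exists_comp_curve_eq_pow_mul hf h (γ := fun r => Φ (r • y))
      (hΦ.comp (by fun_prop)) (by simp [hΦ0])
    rw [(hray y).deriv] at hu0
    have hd : deriv (fun r : ℝ => Φ (r • y)) 0 = fderiv ℝ Φ 0 y := by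
      have h1 : HasFDerivAt Φ (fderiv ℝ Φ 0) ((0 : ℝ) • y) := by
        rw [zero_smul]; exact (hΦ.differentiable (by simp) 0).hasFDerivAt
      exact (h1.comp_hasDerivAt (0 : ℝ) (hray y)).deriv
    rw [hd] at hv0
    have huv : (fun r => r ^ j * u r) = fun r => r ^ k * v r := by
      ext r
      rw [← hFu, ← hfv]; rfl
    rw [← hu0, ← taylorCoeff_pow_mul hu j, huv]
    split_ifs with hjk
    · rw [hjk, taylorCoeff_pow_mul hv, hv0]
    · exact taylorCoeff_pow_mul_of_lt hv (by omega)
  have hord : ∀ j ≤ k, WeightedOrderGE 1 1 j (f ∘ Φ) := by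
    intro j
    induction j with
    | zero => intro _ a b hab; omega
    | succ j ih =>
      intro hj a b hab
      have hj' := ih (by omega)
      rcases Nat.lt_or_ge (1 * a + 1 * b) j with hlt | hge
      · exact hj' a b hlt
      · obtain rfl : b = j - a := by omega
        refine binaryForm_coeff_eq (k := j) (c := fun i => taylorCoefficient (f ∘ Φ) (i, j - i))
          (d := fun _ => 0) (fun y => ?_) (show a ≤ j by omega)
        have := main j (by omega) hj' y
        rw [if_neg (by omega)] at this
        rw [homogeneousPart] at this
        simp [this]
  exact ⟨hord k le_rfl, fun y => by simpa using main k le_rfl (hord k le_rfl) y⟩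

/-! ### Bounds for the Newton distance -/

/-- The half-plane v t₁ + w t₂ ≥ S is convex and, the weights being nonnegative, contains every
quadrant attached to the support. -/
lemma le_newtonDistance {f : ℝ × ℝ → ℝ} {v w S : ℕ} (h : WeightedOrderGE v w S f) {D : ℝ}
    (hvw : 0 < v + w) (hD : D * (v + w) ≤ S) : ENNReal.ofReal D ≤ newtonDistance f := by
  refine le_iInf fun t => le_iInf fun ht => ?_
  have hsub : newtonPolyhedron f ⊆ {p : ℝ × ℝ | (S : ℝ) ≤ v * p.1 + w * p.2} := by
    refine convexHull_min ?_ ?_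
    · refine Set.iUnion₂_subset fun α hα p hp => ?_
      have hS : S ≤ v * α.1 + w * α.2 := by
        by_contra hlt
        exact hα (h α.1 α.2 (by omega))
      have hS' : (S : ℝ) ≤ v * α.1 + w * α.2 := by exact_mod_cast hS
      have h1 := mul_le_mul_of_nonneg_left hp.1 (Nat.cast_nonneg (α := ℝ) v)
      have h2 := mul_le_mul_of_nonneg_left hp.2 (Nat.cast_nonneg (α := ℝ) w)
      simp only [Set.mem_ofPred_eq]
      linarith
    · refine convex_halfSpace_ge ⟨fun p q => ?_, fun c p => ?_⟩ _
      · simp only [Prod.fst_add, Prod.snd_add]; ring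
      · simp only [Prod.smul_fst, Prod.smul_snd, smul_eq_mul]; ring
  have h1 := hsub ht
  simp only [Set.mem_ofPred_eq] at h1
  have hpos : (0 : ℝ) < v + w := by exact_mod_cast hvw
  have h2 : D ≤ t := le_of_mul_le_mul_right (by linarith) hpos
  rw [← ENNReal.ofReal_coe_nnreal]
  exact ENNReal.ofReal_le_ofReal h2

/-- The segment joining the two support points meets the bisectrix inside the polyhedron, at a point
where the weighted degree is at most S. -/
lemma newtonDistance_le {f : ℝ × ℝ → ℝ} {a b c d v w S : ℕ} (h₁ : taylorCoefficient f (a, b) ≠ 0)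
    (h₂ : taylorCoefficient f (c, d) ≠ 0) (hab : a ≤ b) (hcd : d ≤ c) (hS₁ : v * a + w * b ≤ S)
    (hS₂ : v * c + w * d ≤ S) (hvw : 0 < v + w) {D : ℝ} (hD : S ≤ D * (v + w)) :
    newtonDistance f ≤ ENNReal.ofReal D := by
  have hmem : ∀ p q : ℕ, taylorCoefficient f (p, q) ≠ 0 → ((p : ℝ), (q : ℝ)) ∈ newtonPolyhedron f :=
    fun p q hpq => subset_convexHull ℝ _ (Set.mem_iUnion₂.2 ⟨(p, q), hpq, le_rfl, le_rfl⟩)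
  have hpos : (0 : ℝ) < v + w := by exact_mod_cast hvw
  have hS₁' : (v : ℝ) * a + w * b ≤ S := by exact_mod_cast hS₁
  have hS₂' : (v : ℝ) * c + w * d ≤ S := by exact_mod_cast hS₂
  have hab' : (a : ℝ) ≤ b := by exact_mod_cast hab
  have hcd' : (d : ℝ) ≤ c := by exact_mod_cast hcd
  -- The barycentric weights are proportional to the signed distances of the opposite points from
  -- the bisectrix; if both points lie on it, either one will do.
  obtain ⟨l, m, hl, hm, hlm, hdiag⟩ : ∃ l m : ℝ, 0 ≤ l ∧ 0 ≤ m ∧ l + m = 1 ∧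
      l * a + m * c = l * b + m * d := by
    rcases (add_nonneg (sub_nonneg.2 hab') (sub_nonneg.2 hcd')).eq_or_lt with h0 | h0
    · exact ⟨1, 0, by norm_num, le_rfl, by norm_num, by linarith⟩
    · refine ⟨(c - d) / (b - a + (c - d)), (b - a) / (b - a + (c - d)),
        div_nonneg (by linarith) h0.le, div_nonneg (by linarith) h0.le, ?_, ?_⟩ <;>
      · field_simp
        ring
  have ht0 : 0 ≤ l * a + m * c := by positivity
  have hmemt : ((l * a + m * c, l * a + m * c) : ℝ × ℝ) ∈ newtonPolyhedron f := by
    have := (convex_convexHull ℝ _ : Convex ℝ (newtonPolyhedron f)) (hmem a b h₁) (hmem c d h₂)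
      hl hm hlm
    have e : l • ((a : ℝ), (b : ℝ)) + m • ((c : ℝ), (d : ℝ)) = (l * a + m * c, l * a + m * c) := by
      ext
      · simp
      · simp [hdiag]
    rwa [e] at this
  obtain ⟨t, ht⟩ : ∃ t : ℝ≥0, (t : ℝ) = l * a + m * c := ⟨⟨_, ht0⟩, rfl⟩
  rw [← ht] at hmemt
  refine (iInf₂_le t hmemt).trans ?_
  rw [← ENNReal.ofReal_coe_nnreal]
  refine ENNReal.ofReal_le_ofReal (le_of_mul_le_mul_right ?_ hpos)
  rw [ht]
  have e1 := mul_le_mul_of_nonneg_left hS₁' hl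
  have e2 := mul_le_mul_of_nonneg_left hS₂' hm
  have e3 : (l * a + m * c) * ((v : ℝ) + w) =
      l * (v * a + w * b) + m * (v * c + w * d) := by
    linear_combination w * hdiag
  have e4 : l * S + m * S = (S : ℝ) := by rw [← add_mul, hlm, one_mul]
  linarith

lemma newtonDistance_congr {f g : ℝ × ℝ → ℝ} (h : f =ᶠ[𝓝 0] g) :
    newtonDistance f = newtonDistance g := by
  have : taylorSupport f = taylorSupport g := by
    ext α
    simp only [taylorSupport, Set.mem_ofPred_eq, taylorCoefficient_congr h]
  rw [newtonDistance, newtonDistance, newtonPolyhedron, newtonPolyhedron, this]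

/-! ### Upper bounds for the Newton distance in arbitrary coordinates -/

lemma newtonDistance_le_comp_swap {f : ℝ × ℝ → ℝ} (hf : ContDiff ℝ ∞ f) :
    newtonDistance f ≤ newtonDistance (f ∘ Prod.swap) := by
  refine le_iInf₂ fun t ht => iInf₂_le t ?_
  have hsub : newtonPolyhedron (f ∘ Prod.swap) ⊆
      (LinearEquiv.prodComm ℝ ℝ ℝ).toLinearMap ⁻¹' newtonPolyhedron f := by
    refine convexHull_min ?_ ((convex_convexHull ℝ _).linear_preimage _)
    refine Set.iUnion₂_subset fun α hα p hp => subset_convexHull ℝ _ ?_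
    refine Set.mem_iUnion₂.2 ⟨(α.2, α.1), ?_, hp.2, hp.1⟩
    have : taylorCoefficient (f ∘ Prod.swap) (α.1, α.2) ≠ 0 := hα
    rwa [taylorCoefficient_comp_swap hf] at this
  exact hsub ht

lemma exists_matrix_of_bijective {L : ℝ × ℝ →L[ℝ] ℝ × ℝ} (hL : Function.Bijective L) :
    ∃ a b c d : ℝ, (∀ x y, L (x, y) = (a * x + b * y, c * x + d * y)) ∧ a * d - b * c ≠ 0 := by
  have hform : ∀ x y, L (x, y) =
      ((L (1, 0)).1 * x + (L (0, 1)).1 * y, (L (1, 0)).2 * x + (L (0, 1)).2 * y) := by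
    intro x y
    have : ((x, y) : ℝ × ℝ) = x • (1, 0) + y • (0, 1) := by simp
    rw [this, map_add, map_smul, map_smul]
    ext <;> simp [mul_comm]
  refine ⟨_, _, _, _, hform, fun hdet => ?_⟩
  have hinj : ∀ x y, L (x, y) = 0 → x = 0 ∧ y = 0 := fun x y h => by
    have := hL.1 (h.trans (map_zero L).symm)
    simpa using this
  -- If the determinant vanishes, (d, −c) and (b, −a) lie in the kernel, so all entries are zero.
  have h1 := hinj (L (0, 1)).2 (-(L (1, 0)).2) (by
    rw [hform]
    ext
    · simp only [Prod.fst_zero]; linarith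
    · simp only [Prod.snd_zero]; ring)
  have h2 := hinj (L (0, 1)).1 (-(L (1, 0)).1) (by
    rw [hform]
    ext
    · simp only [Prod.fst_zero]; ring
    · simp only [Prod.snd_zero]; linarith)
  have h3 := hinj 1 0 (by
    ext
    · simpa using h2.2
    · simpa using h1.2)
  exact one_ne_zero h3.1

lemma homogeneousPart_two (f : ℝ × ℝ → ℝ) (x y : ℝ) : homogeneousPart f 2 (x, y) =
    taylorCoefficient f (0, 2) * y ^ 2 + taylorCoefficient f (1, 1) * (x * y) +
      taylorCoefficient f (2, 0) * x ^ 2 := by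
  simp [homogeneousPart, Finset.sum_range_succ]

lemma homogeneousPart_three (f : ℝ × ℝ → ℝ) (x y : ℝ) : homogeneousPart f 3 (x, y) =
    taylorCoefficient f (0, 3) * y ^ 3 + taylorCoefficient f (1, 2) * (x * y ^ 2) +
      taylorCoefficient f (2, 1) * (x ^ 2 * y) + taylorCoefficient f (3, 0) * x ^ 3 := by
  simp [homogeneousPart, Finset.sum_range_succ]

lemma fderiv_comp_swap {Φ : ℝ × ℝ → ℝ × ℝ} (hΦ : ContDiff ℝ ∞ Φ) :
    fderiv ℝ (Φ ∘ Prod.swap) 0 = (fderiv ℝ Φ 0).comp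
      (ContinuousLinearEquiv.prodComm ℝ ℝ ℝ : ℝ × ℝ →L[ℝ] ℝ × ℝ) :=
  (HasFDerivAt.comp (0 : ℝ × ℝ) (hΦ.differentiable (by simp) _).hasFDerivAt
    (ContinuousLinearEquiv.prodComm ℝ ℝ ℝ).hasFDerivAt).fderiv

lemma bijective_fderiv_comp_swap {Φ : ℝ × ℝ → ℝ × ℝ} (hΦ : ContDiff ℝ ∞ Φ)
    (hbij : Function.Bijective (fderiv ℝ Φ 0)) :
    Function.Bijective (fderiv ℝ (Φ ∘ Prod.swap) 0) := by
  rw [fderiv_comp_swap hΦ]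
  exact hbij.comp (ContinuousLinearEquiv.prodComm ℝ ℝ ℝ).bijective

/-- To bound the Newton distances in all coordinate systems, one may assume that the linear part of
the coordinate change either preserves the first axis or maps no axis to the first axis. -/
lemma newtonDistance_comp_le_of_axis {φ : ℝ × ℝ → ℝ} (hφ : ContDiff ℝ ∞ φ) {D : ℝ≥0∞}
    (H : ∀ Φ : ℝ × ℝ → ℝ × ℝ, ContDiff ℝ ∞ Φ → Φ 0 = 0 → Function.Bijective (fderiv ℝ Φ 0) →
      ((fderiv ℝ Φ 0 (1, 0)).2 = 0 ∨ (fderiv ℝ Φ 0 (1, 0)).2 ≠ 0 ∧ (fderiv ℝ Φ 0 (0, 1)).2 ≠ 0) →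
      newtonDistance (φ ∘ Φ) ≤ D)
    {Φ : ℝ × ℝ → ℝ × ℝ} (hΦ : ContDiff ℝ ∞ Φ) (hΦ0 : Φ 0 = 0)
    (hbij : Function.Bijective (fderiv ℝ Φ 0)) : newtonDistance (φ ∘ Φ) ≤ D := by
  -- If the second axis is mapped to the first, interchanging the source coordinates reduces to the
  -- first alternative.
  by_cases hd : (fderiv ℝ Φ 0 (0, 1)).2 = 0
  · refine (newtonDistance_le_comp_swap (hφ.comp hΦ)).trans
      (H (Φ ∘ Prod.swap) (hΦ.comp (contDiff_snd.prodMk contDiff_fst)) hΦ0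
        (bijective_fderiv_comp_swap hΦ hbij) (Or.inl ?_))
    rw [fderiv_comp_swap hΦ]
    exact hd
  · exact H Φ hΦ hΦ0 hbij ((em _).imp_right fun hc => ⟨hc, hd⟩)

/-- If the quadratic part of `f` is a multiple of `x₂ ^ 2`, then only those coordinate changes
whose linear part preserves the first axis have to be considered to bound Newton distances. -/
lemma newtonDistance_comp_le_of_quadratic {φ : ℝ × ℝ → ℝ} (hφ : ContDiff ℝ ∞ φ)
    (hord : WeightedOrderGE 1 1 2 φ) (h20 : taylorCoefficient φ (2, 0) = 0)
    (h11 : taylorCoefficient φ (1, 1) = 0) (h02 : taylorCoefficient φ (0, 2) ≠ 0) {D : ℝ}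
    (hD : 1 ≤ D)
    (H : ∀ Φ : ℝ × ℝ → ℝ × ℝ, ContDiff ℝ ∞ Φ → Φ 0 = 0 → Function.Bijective (fderiv ℝ Φ 0) →
      (fderiv ℝ Φ 0 (1, 0)).2 = 0 → newtonDistance (φ ∘ Φ) ≤ ENNReal.ofReal D)
    {Φ : ℝ × ℝ → ℝ × ℝ} (hΦ : ContDiff ℝ ∞ Φ) (hΦ0 : Φ 0 = 0)
    (hbij : Function.Bijective (fderiv ℝ Φ 0)) :
    newtonDistance (φ ∘ Φ) ≤ ENNReal.ofReal D := by
  refine newtonDistance_comp_le_of_axis hφ (fun Φ hΦ hΦ0 hbij hcd => ?_) hΦ hΦ0 hbij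
  rcases hcd with hc | ⟨hc, hd⟩
  · exact H Φ hΦ hΦ0 hbij hc
  obtain ⟨a, b, c, d, hL, -⟩ := exists_matrix_of_bijective hbij
  replace hc : c ≠ 0 := by simpa [hL] using hc
  replace hd : d ≠ 0 := by simpa [hL] using hd
  have hpart : ∀ x y, homogeneousPart (φ ∘ Φ) 2 (x, y) =
      taylorCoefficient φ (0, 2) * (c * x + d * y) ^ 2 := fun x y => by
    rw [(hord.comp hφ hΦ hΦ0).2, hL, homogeneousPart_two, h20, h11]; ring
  simp only [homogeneousPart_two] at hpart
  -- The square of c x + d y has a mixed term, which puts (1, 1) on the bisectrix and bounds the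
  -- distance by 1.
  have h11' : taylorCoefficient (φ ∘ Φ) (1, 1) ≠ 0 := by
    have e : taylorCoefficient (φ ∘ Φ) (1, 1) = 2 * taylorCoefficient φ (0, 2) * c * d := by
      linear_combination (hpart 1 1 - hpart 1 (-1)) / 2
    rw [e]
    positivity
  exact newtonDistance_le (v := 1) (w := 1) (S := 2) h11' h11' le_rfl le_rfl (by norm_num)
    (by norm_num) (by norm_num) (by push_cast; linarith)

/-- If the cubic part of `f` is divisible by `x₂ ^ 2`, then only those coordinate changes
whose linear part preserves the first axis have to be considered to bound Newton distances. -/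
lemma newtonDistance_comp_le_of_cubic {φ : ℝ × ℝ → ℝ} (hφ : ContDiff ℝ ∞ φ)
    (hord : WeightedOrderGE 1 1 3 φ) (h30 : taylorCoefficient φ (3, 0) = 0)
    (h21 : taylorCoefficient φ (2, 1) = 0)
    (hne : taylorCoefficient φ (1, 2) ≠ 0 ∨ taylorCoefficient φ (0, 3) ≠ 0) {D : ℝ}
    (hD : 3 / 2 ≤ D)
    (H : ∀ Φ : ℝ × ℝ → ℝ × ℝ, ContDiff ℝ ∞ Φ → Φ 0 = 0 → Function.Bijective (fderiv ℝ Φ 0) →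
      (fderiv ℝ Φ 0 (1, 0)).2 = 0 → newtonDistance (φ ∘ Φ) ≤ ENNReal.ofReal D)
    {Φ : ℝ × ℝ → ℝ × ℝ} (hΦ : ContDiff ℝ ∞ Φ) (hΦ0 : Φ 0 = 0)
    (hbij : Function.Bijective (fderiv ℝ Φ 0)) :
    newtonDistance (φ ∘ Φ) ≤ ENNReal.ofReal D := by
  refine newtonDistance_comp_le_of_axis hφ (fun Φ hΦ hΦ0 hbij hcd => ?_) hΦ hΦ0 hbij
  rcases hcd with hc | ⟨hc, hd⟩
  · exact H Φ hΦ hΦ0 hbij hc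
  obtain ⟨a, b, c, d, hL, hdet⟩ := exists_matrix_of_bijective hbij
  replace hc : c ≠ 0 := by simpa [hL] using hc
  replace hd : d ≠ 0 := by simpa [hL] using hd
  set p := taylorCoefficient φ (1, 2)
  set q := taylorCoefficient φ (0, 3)
  set A := p * a + q * c with hA
  set B := p * b + q * d with hB
  -- (A, B) is the nonzero row (p, q) times the invertible Jacobian matrix.
  have hAB : A ≠ 0 ∨ B ≠ 0 := by
    by_contra h
    push Not at h
    have hp : p * (a * d - b * c) = 0 := by
      linear_combination d * h.1 - c * h.2 - d * hA + c * hB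
    have hp0 : p = 0 := (mul_eq_zero.1 hp).resolve_right hdet
    have hq : q * c = 0 := by rw [hp0] at hA; linarith [h.1]
    have hq0 : q = 0 := (mul_eq_zero.1 hq).resolve_right hc
    exact hne.elim (· hp0) (· hq0)
  have hpart : ∀ x y, homogeneousPart (φ ∘ Φ) 3 (x, y) =
      (c * x + d * y) ^ 2 * (A * x + B * y) := fun x y => by
    rw [(hord.comp hφ hΦ hΦ0).2, hL, homogeneousPart_three, h30, h21, hA, hB]; ring
  simp only [homogeneousPart_three] at hpart
  have e30 : taylorCoefficient (φ ∘ Φ) (3, 0) = c ^ 2 * A := by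
    linear_combination hpart 1 0
  have e03 : taylorCoefficient (φ ∘ Φ) (0, 3) = d ^ 2 * B := by
    linear_combination hpart 0 1
  have e21 : taylorCoefficient (φ ∘ Φ) (2, 1) = c ^ 2 * B + 2 * c * d * A := by
    linear_combination (hpart 1 1 - hpart 1 (-1)) / 2 - e03
  have e12 : taylorCoefficient (φ ∘ Φ) (1, 2) = d ^ 2 * A + 2 * c * d * B := by
    linear_combination (hpart 1 1 + hpart 1 (-1)) / 2 - e30
  -- Since c, d ≠ 0, the form (c x + d y)²(A x + B y) has a monomial on each side of the bisectrix;
  -- hence the distance is at most 3/2.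
  have hlow : ∃ i j, j ≤ i ∧ i + j = 3 ∧ taylorCoefficient (φ ∘ Φ) (i, j) ≠ 0 := by
    by_cases hA0 : A = 0
    · refine ⟨2, 1, by norm_num, rfl, ?_⟩
      have := hAB.resolve_left (not_not.2 hA0)
      rw [e21, hA0, mul_zero, add_zero]
      positivity
    · exact ⟨3, 0, by norm_num, rfl, by rw [e30]; positivity⟩
  have hupp : ∃ i j, i ≤ j ∧ i + j = 3 ∧ taylorCoefficient (φ ∘ Φ) (i, j) ≠ 0 := by
    by_cases hB0 : B = 0
    · refine ⟨1, 2, by norm_num, rfl, ?_⟩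
      have := hAB.resolve_right (not_not.2 hB0)
      rw [e12, hB0, mul_zero, add_zero]
      positivity
    · exact ⟨0, 3, by norm_num, rfl, by rw [e03]; positivity⟩
  obtain ⟨i, j, hij, hs, h1⟩ := hlow
  obtain ⟨k, l, hkl, hs', h2⟩ := hupp
  exact newtonDistance_le (v := 1) (w := 1) (S := 3) h2 h1 hkl hij (by omega)
    (by omega) (by norm_num) (by push_cast; linarith)

/-! ### Newton distance of a square plus a power -/

lemma contDiff_deriv_snd {h : ℝ × ℝ → ℝ} (hh : ContDiff ℝ ∞ h) :
    ContDiff ℝ ∞ fun s => deriv (fun y => h (s, y)) 0 := by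
  have : (fun s => deriv (fun y => h (s, y)) 0) = sliceCoeff h 1 := by
    ext s; exact (taylorCoeff_one _).symm
  rw [this]; exact contDiff_sliceCoeff hh 1

lemma hasDerivAt_snd {h : ℝ × ℝ → ℝ} (hh : ContDiff ℝ ∞ h) (s : ℝ) :
    HasDerivAt (fun y => h (s, y)) (deriv (fun y => h (s, y)) 0) 0 :=
  ((hh.comp (by fun_prop : ContDiff ℝ ∞ fun y : ℝ => (s, y))).differentiable (by simp) 0).hasDerivAt

/-- A bound for the Newton distance of `H * g ^ 2 + B ∘ f`, where `B` has order `n` and `(f, g)` is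
a coordinate system in which the first axis is tangent to `{g = 0}`. -/
lemma newtonDistance_le_of_square_add {H f g : ℝ × ℝ → ℝ} {v β : ℝ → ℝ} {ε n : ℕ}
    (hH : ContDiff ℝ ∞ H) (hf : ContDiff ℝ ∞ f) (hg : ContDiff ℝ ∞ g) (hv : ContDiff ℝ ∞ v)
    (hβ : ContDiff ℝ ∞ β) (hε : ε ≤ 1) (hHv : ∀ s, H (s, 0) = s ^ ε * v s) (hv0 : v 0 ≠ 0)
    (hβ0 : β 0 ≠ 0) (hf0 : f (0, 0) = 0) (hg0 : g (0, 0) = 0)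
    (hf1 : deriv (fun s => f (s, 0)) 0 ≠ 0) (hg1 : deriv (fun s => g (s, 0)) 0 = 0)
    (hg2 : deriv (fun y => g (0, y)) 0 ≠ 0) (hn : ε < n)
    (hc : taylorCoefficient (fun p => H p * g p ^ 2 + f p ^ n * β (f p)) (ε, 2) ≠ 0) {D : ℝ}
    (hD : 2 * n ≤ D * (2 + (n - ε))) :
    newtonDistance (fun p => H p * g p ^ 2 + f p ^ n * β (f p)) ≤ ENNReal.ofReal D := by
  have hline : ∀ h : ℝ × ℝ → ℝ, ContDiff ℝ ∞ h → ContDiff ℝ ∞ fun s => h (s, 0) :=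
    fun h hh => hh.comp (by fun_prop)
  set F : ℝ × ℝ → ℝ := fun p => H p * g p ^ 2 + f p ^ n * β (f p) with hF
  have hDn : ((2 * n : ℕ) : ℝ) ≤ D * ((2 : ℕ) + ((n - ε : ℕ) : ℝ)) := by
    push_cast [Nat.cast_sub hn.le]; linarith
  obtain ⟨p, rfl⟩ := Nat.exists_eq_add_of_lt hn
  -- The points (ε, 2) and (n, 0) span the line 2t₁ + (n − ε)t₂ = 2n, where now n − ε = p + 1. One
  -- further support point below the bisectrix and not above this line suffices.
  have hbound : ∀ i j, taylorCoefficient F (i, j) ≠ 0 → j ≤ i →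
      2 * i + (p + 1) * j ≤ 2 * (ε + p + 1) → newtonDistance F ≤ ENNReal.ofReal D := by
    intro i j hij hji hS
    refine newtonDistance_le hc hij (by omega) hji (v := 2) (w := ε + p + 1 - ε)
      (S := 2 * (ε + p + 1)) ?_ ?_ (by omega) hDn
    · omega
    · rwa [show ε + p + 1 - ε = p + 1 by omega]
  obtain ⟨u, hu, hfu, hu0⟩ := exists_eq_pow_mul (hline f hf) (k := 1) fun j hj => by
    obtain rfl : j = 0 := by omega
    simpa using hf0
  rw [taylorCoeff_one] at hu0
  simp only [pow_one] at hfu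
  have hu0' : u 0 ≠ 0 := hu0 ▸ hf1
  have hF0 : ∀ s, F (s, 0) = s ^ ε * v s * g (s, 0) ^ 2 +
      (s * u s) ^ (ε + p + 1) * β (s * u s) := fun s => by simp only [hF, hHv, hfu]
  -- If 2K + ε > n, the square is of higher order on the first axis, and the power of f leaves the
  -- point (n, 0).
  have hlarge : ∀ (K : ℕ) (w : ℝ → ℝ), ContDiff ℝ ∞ w → (∀ s, g (s, 0) = s ^ K * w s) →
      ε + p + 1 < 2 * K + ε → newtonDistance F ≤ ENNReal.ofReal D := by
    intro K w hw hgw hK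
    refine hbound (ε + p + 1) 0 ?_ (by omega) (by omega)
    obtain ⟨q, hq⟩ := Nat.exists_eq_add_of_lt hK
    have : (fun s => F (s, 0)) = fun s => s ^ (ε + p + 1) *
        (s * (s ^ q * (v s * w s ^ 2)) + u s ^ (ε + p + 1) * β (s * u s)) := by
      ext s
      have e : s ^ ε * (s ^ K) ^ 2 = s ^ (ε + p + 1) * (s * s ^ q) := by
        rw [← pow_mul, ← pow_add, ← pow_succ', ← pow_add]; congr 1; omega
      rw [hF0, hgw, mul_pow, mul_pow]
      linear_combination v s * w s ^ 2 * e
    rw [taylorCoefficient_zero_right, this, taylorCoeff_pow_mul (by fun_prop)]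
    simpa using ⟨hu0', hβ0⟩
  rcases exists_order_lt_or_eq_pow_mul (hline g hg) (ε + p + 1) with
    ⟨k, w, -, hw, hw0, hgw⟩ | ⟨w, hw, hgw⟩
  swap
  · exact hlarge _ w hw hgw (by omega)
  have hk0 : k ≠ 0 := by
    rintro rfl
    have := hgw 0
    rw [hg0, pow_zero, one_mul] at this
    exact hw0 this.symm
  have hk1 : k ≠ 1 := by
    rintro rfl
    rw [← taylorCoeff_one, funext hgw, taylorCoeff_pow_mul hw] at hg1
    exact hw0 hg1
  obtain ⟨q, rfl⟩ : ∃ q, k = q + 2 := ⟨k - 2, by omega⟩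
  rcases lt_trichotomy (2 * (q + 2) + ε) (ε + p + 1) with hlt | heq | hgt
  -- Here the square dominates on the first axis, g(s, 0) having order k = q + 2.
  · refine hbound (2 * (q + 2) + ε) 0 ?_ (by omega) (by omega)
    obtain ⟨r, hr⟩ := Nat.exists_eq_add_of_lt hlt
    have : (fun s => F (s, 0)) = fun s => s ^ (2 * (q + 2) + ε) *
        (v s * w s ^ 2 + s * (s ^ r * (u s ^ (ε + p + 1) * β (s * u s)))) := by
      ext s
      rw [hF0, hgw, mul_pow s, hr]
      ring
    rw [taylorCoefficient_zero_right, this, taylorCoeff_pow_mul (by fun_prop)]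
    simpa using ⟨hv0, hw0⟩
  -- For 2k + ε = n the two terms may cancel on the axis, but (k + ε, 1) lies on the same line. Its
  -- coefficient comes from 2 H g ∂₂g alone: the other terms of the x₂-derivative have higher order
  -- because k ≥ 2.
  · refine hbound (q + 2 + ε) 1 ?_ (by omega) (by omega)
    have hp : p = 2 * q + 3 := by omega
    subst hp
    set H1 := fun s => deriv (fun y => H (s, y)) 0
    set g1 := fun s => deriv (fun y => g (s, y)) 0
    set f1 := fun s => deriv (fun y => f (s, y)) 0
    have hH1 : ContDiff ℝ ∞ H1 := contDiff_deriv_snd hH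
    have hgs : ContDiff ℝ ∞ g1 := contDiff_deriv_snd hg
    have hfs : ContDiff ℝ ∞ f1 := contDiff_deriv_snd hf
    have hβ' : ContDiff ℝ ∞ (deriv β) := (contDiff_infty_iff_deriv.1 hβ).2
    obtain ⟨r, hr⟩ : ∃ r, q + r = 2 * q + 1 - ε ∧ q + 2 + ε + 1 + r = 2 * (q + 2) :=
      ⟨q + 1 - ε, by omega, by omega⟩
    have hFder : ∀ s, deriv (fun y => F (s, y)) 0 = s ^ (q + 2 + ε) *
        (s * (s ^ r * (H1 s * w s ^ 2)) + 2 * v s * w s * g1 s +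
          s * (s ^ q * (((ε + (2 * q + 3) + 1 : ℕ) * u s ^ (ε + (2 * q + 3)) * β (s * u s) +
            s * u s ^ (ε + (2 * q + 3) + 1) * deriv β (s * u s)) * f1 s))) := by
      intro s
      have hfd : HasDerivAt (fun y => f (s, y)) (f1 s) 0 := hasDerivAt_snd hf s
      have h1 := ((hasDerivAt_snd hH s).mul ((hasDerivAt_snd hg s).pow 2)).add ((hfd.pow
        (ε + (2 * q + 3) + 1)).mul (((hβ.differentiable (by simp)
          (f (s, 0))).hasDerivAt).comp (0 : ℝ) hfd))
      have e : (s ^ (q + 2)) ^ 2 = s ^ (q + 2 + ε) * s * s ^ r := by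
        rw [← pow_mul, ← pow_succ, ← pow_add]; congr 1; omega
      refine h1.deriv.trans ?_
      simp only [Pi.pow_apply, Function.comp_apply, hfu, hgw, hHv, Nat.add_sub_cancel]
      rw [mul_pow (s ^ (q + 2)), e]
      push_cast
      ring
    rw [taylorCoefficient_one_right, funext hFder, taylorCoeff_pow_mul (by fun_prop)]
    simpa using ⟨⟨hv0, hw0⟩, hg2⟩
  · exact hlarge _ w hw hgw hgt

/-! ### Cubic part a multiple of a cube -/

lemma homogeneousPart_one (f : ℝ × ℝ → ℝ) (x y : ℝ) : homogeneousPart f 1 (x, y) =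
    taylorCoefficient f (0, 1) * y + taylorCoefficient f (1, 0) * x := by
  simp [homogeneousPart, Finset.sum_range_succ]

/-- First-order data of the components of a coordinate change preserving the first axis to first
order. -/
lemma components_of_axis {Φ : ℝ × ℝ → ℝ × ℝ} (hΦ : ContDiff ℝ ∞ Φ)
    {a b d : ℝ} (hL : ∀ x y, fderiv ℝ Φ 0 (x, y) = (a * x + b * y, 0 * x + d * y)) :
    HasDerivAt (fun s => Φ (s, 0)) (a, 0) 0 ∧ deriv (fun s => (Φ (s, 0)).1) 0 = a ∧
      deriv (fun s => (Φ (s, 0)).2) 0 = 0 ∧ deriv (fun y => (Φ (0, y)).1) 0 = b ∧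
      deriv (fun y => (Φ (0, y)).2) 0 = d := by
  have hd : HasFDerivAt Φ (fderiv ℝ Φ 0) ((0 : ℝ), (0 : ℝ)) :=
    (hΦ.differentiable (by simp) 0).hasFDerivAt
  have h1 : HasDerivAt (fun s => Φ (s, 0)) (fderiv ℝ Φ 0 (1, 0)) 0 :=
    hd.comp_hasDerivAt (f := fun s : ℝ => (s, (0 : ℝ))) (0 : ℝ)
      ((hasDerivAt_id (0 : ℝ)).prodMk (hasDerivAt_const _ (0 : ℝ)))
  have h2 : HasDerivAt (fun y => Φ (0, y)) (fderiv ℝ Φ 0 (0, 1)) 0 :=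
    hd.comp_hasDerivAt (f := fun y : ℝ => ((0 : ℝ), y)) (0 : ℝ)
      ((hasDerivAt_const _ (0 : ℝ)).prodMk (hasDerivAt_id (0 : ℝ)))
  rw [show fderiv ℝ Φ 0 (1, 0) = (a, 0) by rw [hL]; simp] at h1
  rw [show fderiv ℝ Φ 0 (0, 1) = (b, d) by rw [hL]; simp] at h2
  have fst : ∀ {γ : ℝ → ℝ × ℝ} {v : ℝ × ℝ}, HasDerivAt γ v 0 → deriv (fun s => (γ s).1) 0 = v.1 :=
    fun {γ _} h => ((hasFDerivAt_fst (𝕜 := ℝ) (E := ℝ) (F := ℝ) (p := γ 0)).comp_hasDerivAt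
      (0 : ℝ) h).deriv
  have snd : ∀ {γ : ℝ → ℝ × ℝ} {v : ℝ × ℝ}, HasDerivAt γ v 0 → deriv (fun s => (γ s).2) 0 = v.2 :=
    fun {γ _} h => ((hasFDerivAt_snd (𝕜 := ℝ) (E := ℝ) (F := ℝ) (p := γ 0)).comp_hasDerivAt
      (0 : ℝ) h).deriv
  exact ⟨h1, fst h1, snd h1, fst h2, snd h2⟩

/-- If the cubic part of `φ` is a multiple of `x₂ ^ 3`, then the first non-vanishing one among the
coefficients of `x₁ ^ 4`, `x₁ ^ 3 * x₂` and `x₁ ^ 5` remains non-zero under coordinate changes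
which preserve the first axis to first order. -/
lemma taylorCoefficient_comp_ne_zero_of_cube {φ : ℝ × ℝ → ℝ} (hφ : ContDiff ℝ ∞ φ)
    (hord : WeightedOrderGE 1 1 3 φ) (h30 : taylorCoefficient φ (3, 0) = 0)
    (h21 : taylorCoefficient φ (2, 1) = 0) (h12 : taylorCoefficient φ (1, 2) = 0)
    {Φ : ℝ × ℝ → ℝ × ℝ} (hΦ : ContDiff ℝ ∞ Φ) (hΦ0 : Φ 0 = 0) {a b d : ℝ}
    (hL : ∀ x y, fderiv ℝ Φ 0 (x, y) = (a * x + b * y, 0 * x + d * y)) (ha : a ≠ 0) (hd : d ≠ 0) :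
    (taylorCoefficient φ (4, 0) ≠ 0 → taylorCoefficient (φ ∘ Φ) (4, 0) ≠ 0) ∧
    (taylorCoefficient φ (4, 0) = 0 → taylorCoefficient φ (3, 1) ≠ 0 →
      taylorCoefficient (φ ∘ Φ) (3, 1) ≠ 0) ∧
    (taylorCoefficient φ (4, 0) = 0 → taylorCoefficient φ (3, 1) = 0 →
      taylorCoefficient φ (5, 0) ≠ 0 → taylorCoefficient (φ ∘ Φ) (5, 0) ≠ 0) := by
  obtain ⟨hdx, hfx, hgx, -, hgy⟩ := components_of_axis hΦ hL
  obtain ⟨k, hk, hφk⟩ := exists_eq_add_snd_mul hφ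
  obtain ⟨h, hh, hkh⟩ := exists_eq_add_snd_mul hk
  have hck : ∀ i j, taylorCoefficient φ (i, j + 1) = taylorCoefficient k (i, j) :=
    taylorCoefficient_snd_succ hk hφk
  have hch : ∀ i j, taylorCoefficient φ (i, j + 2) = taylorCoefficient h (i, j) := fun i j => by
    rw [hck, taylorCoefficient_snd_succ hh hkh]
  -- This prepares φ = x₁⁴A(x₁) + x₂x₁³C(x₁) + x₂²h, where A(0) and C(0) are the coefficients at (4,
  -- 0) and (3, 1).
  obtain ⟨A, hA, hφA, hA0⟩ := exists_eq_pow_mul (f := fun x => φ (x, 0)) (hφ.comp (by fun_prop))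
    (k := 4) fun j hj => by
      rw [← taylorCoefficient_zero_right]
      rcases Nat.lt_or_ge j 3 with h3 | h3
      · exact hord _ _ (by omega)
      · obtain rfl : j = 3 := by omega
        exact h30
  obtain ⟨C, hC, hkC, hC0⟩ := exists_eq_pow_mul (f := fun x => k (x, 0)) (hk.comp (by fun_prop))
    (k := 3) fun j hj => by
      rw [← taylorCoefficient_zero_right, ← hck]
      rcases Nat.lt_or_ge j 2 with h3 | h3
      · exact hord _ _ (by omega)
      · obtain rfl : j = 2 := by omega
        exact h21
  rw [← taylorCoefficient_zero_right] at hA0 hC0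
  rw [← hck] at hC0
  set f : ℝ × ℝ → ℝ := fun p => (Φ p).1 with hf_def
  set g : ℝ × ℝ → ℝ := fun p => (Φ p).2 with hg_def
  have hf : ContDiff ℝ ∞ f := contDiff_fst.comp hΦ
  have hg : ContDiff ℝ ∞ g := contDiff_snd.comp hΦ
  have hΦ00 : Φ (0, 0) = (0, 0) := hΦ0
  obtain ⟨u, hu, hfu, hu0⟩ := exists_eq_pow_mul (f := fun s => f (s, 0)) (hf.comp (by fun_prop))
    (k := 1) fun j hj => by
      obtain rfl : j = 0 := by omega
      simp [hf_def, hΦ00]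
  replace hu0 : u 0 = a :=
    (hu0.trans (taylorCoeff_one _)).trans hfx
  simp only [pow_one] at hfu
  obtain ⟨w, hw, hgw, -⟩ := exists_eq_pow_mul (f := fun s => g (s, 0)) (hg.comp (by fun_prop))
    (k := 2) fun j hj => by
      rcases j with _ | j
      · simp [hg_def, hΦ00]
      · obtain rfl : j = 0 := by omega
        exact (taylorCoeff_one _).trans hgx
  -- Both h and ∂₁h vanish at the origin, and the image of the first axis is tangent to that axis,
  -- so h is divisible by s² along it. As g(s, 0) is also divisible by s², the term g²h is of order
  -- at least 6 there.
  obtain ⟨q₁, hq₁, hhq₁, hq₁0⟩ := exists_comp_curve_eq_pow_mul hh (k := 1) (fun i j hij => by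
    rw [← hch]; exact hord _ _ (by omega)) (γ := fun s => Φ (s, 0)) (hΦ.comp (by fun_prop)) hΦ0
  rw [hdx.deriv, homogeneousPart_one, ← hch, ← hch, h12, mul_zero, zero_mul, add_zero] at hq₁0
  obtain ⟨q, hq, hhq⟩ := exists_eq_add_mul hq₁
  replace hhq : ∀ s, h (f (s, 0), g (s, 0)) = s ^ 2 * q s := fun s => by
    change h (Φ (s, 0)) = _
    rw [hhq₁, hhq, hq₁0]; ring
  have hF : ∀ p, (φ ∘ Φ) p = f p ^ 4 * A (f p) + g p * (f p ^ 3 * C (f p)) +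
      g p * g p * h (f p, g p) := fun p => by
    have : (φ ∘ Φ) p = φ (f p, g p) := rfl
    rw [this, hφk, hφA, hkh, hkC]; ring
  have hF0 : ∀ s, (φ ∘ Φ) (s, 0) = s ^ 4 * (u s ^ 4 * A (s * u s) +
      s * (w s * u s ^ 3 * C (s * u s) + s * (w s ^ 2 * q s))) := fun s => by
    rw [hF, hhq, hfu, hgw]; ring
  refine ⟨fun h40 => ?_, fun h40 h31 => ?_, fun h40 h31 h50 => ?_⟩
  · rw [taylorCoefficient_zero_right, funext hF0, taylorCoeff_pow_mul (by fun_prop)]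
    simpa [hu0, ha, hA0] using h40
  · obtain ⟨E, hE, hAE⟩ := exists_eq_add_mul hA
    replace hAE : ∀ x, A x = x * E x := fun x => by rw [hAE, hA0, h40, zero_add]
    set H1 := fun s => deriv (fun y => h (f (s, y), g (s, y))) 0
    set g1 := fun s => deriv (fun y => g (s, y)) 0
    set f1 := fun s => deriv (fun y => f (s, y)) 0
    have hhΦ : ContDiff ℝ ∞ fun p => h (f p, g p) := hh.comp (hf.prodMk hg)
    have hH1 : ContDiff ℝ ∞ H1 := contDiff_deriv_snd hhΦ
    have hgs : ContDiff ℝ ∞ g1 := contDiff_deriv_snd hg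
    have hfs : ContDiff ℝ ∞ f1 := contDiff_deriv_snd hf
    have hE' : ContDiff ℝ ∞ (deriv E) := (contDiff_infty_iff_deriv.1 hE).2
    have hC' : ContDiff ℝ ∞ (deriv C) := (contDiff_infty_iff_deriv.1 hC).2
    have hg10 : g1 0 = d := hgy
    have hFder : ∀ s, deriv (fun y => (φ ∘ Φ) (s, y)) 0 = s ^ 3 * (g1 s * u s ^ 3 * C (s * u s) +
        s * ((5 * u s ^ 4 * E (s * u s) + s * u s ^ 5 * deriv E (s * u s)) * f1 s +
          w s * (3 * u s ^ 2 * C (s * u s) + s * u s ^ 3 * deriv C (s * u s)) * f1 s +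
          2 * w s * g1 s * q s + w s ^ 2 * H1 s)) := by
      intro s
      have e : (fun y => (φ ∘ Φ) (s, y)) = fun y => f (s, y) ^ 5 * E (f (s, y)) +
          g (s, y) * (f (s, y) ^ 3 * C (f (s, y))) +
          g (s, y) * g (s, y) * h (f (s, y), g (s, y)) := by
        ext y
        rw [hF, hAE]; ring
      have hfd : HasDerivAt (fun y => f (s, y)) (f1 s) 0 := hasDerivAt_snd hf s
      have hgd : HasDerivAt (fun y => g (s, y)) (g1 s) 0 := hasDerivAt_snd hg s
      have hhd : HasDerivAt (fun y => h (f (s, y), g (s, y))) (H1 s) 0 := hasDerivAt_snd hhΦ s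
      have h1 := (((hfd.pow 5).mul (((hE.differentiable (by simp)
          (f (s, 0))).hasDerivAt).comp (0 : ℝ) hfd)).add (hgd.mul ((hfd.pow 3).mul
          (((hC.differentiable (by simp) (f (s, 0))).hasDerivAt).comp (0 : ℝ) hfd)))).add
          ((hgd.mul hgd).mul hhd)
      rw [e]
      refine h1.deriv.trans ?_
      simp only [Pi.pow_apply, Pi.mul_apply, Function.comp_apply, hhq]
      simp only [hfu, hgw]
      push_cast
      ring
    rw [taylorCoefficient_one_right, funext hFder, taylorCoeff_pow_mul (by fun_prop)]
    simpa [hu0, ha, hC0, hg10, hd] using h31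
  · obtain ⟨E, hE, hAE⟩ := exists_eq_add_mul hA
    replace hAE : ∀ x, A x = x * E x := fun x => by rw [hAE, hA0, h40, zero_add]
    have hE0 : E 0 = taylorCoefficient φ (5, 0) := by
      have : (fun x => φ (x, 0)) = fun x => x ^ 5 * E x := by
        ext x; rw [hφA, hAE]; ring
      rw [taylorCoefficient_zero_right, this, taylorCoeff_pow_mul hE]
    have : (fun s => (φ ∘ Φ) (s, 0)) = fun s => s ^ 5 * (u s ^ 5 * E (s * u s) +
        w s * u s ^ 3 * C (s * u s) + s * (w s ^ 2 * q s)) := by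
      ext s; rw [hF0, hAE]; ring
    rw [taylorCoefficient_zero_right, this, taylorCoeff_pow_mul (by fun_prop)]
    simpa [hu0, ha, hC0, h31, hE0] using h50

/-- If the cubic part of `φ` is a non-zero multiple of `x₂ ^ 3`, then the given coordinates are
adapted, or the Newton distance is at least two. -/
lemma newtonDistance_comp_le_of_cube {φ : ℝ × ℝ → ℝ} (hφ : ContDiff ℝ ∞ φ)
    (hord : WeightedOrderGE 1 1 3 φ) (h30 : taylorCoefficient φ (3, 0) = 0)
    (h21 : taylorCoefficient φ (2, 1) = 0) (h12 : taylorCoefficient φ (1, 2) = 0)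
    (h03 : taylorCoefficient φ (0, 3) ≠ 0) (hd2 : newtonDistance φ < 2)
    {Φ : ℝ × ℝ → ℝ × ℝ} (hΦ : ContDiff ℝ ∞ Φ) (hΦ0 : Φ 0 = 0)
    (hbij : Function.Bijective (fderiv ℝ Φ 0)) :
    newtonDistance (φ ∘ Φ) ≤ newtonDistance φ := by
  -- Apart from (4, 0), (3, 1) and (5, 0), every possible support point dominates one of (0, 3), (2,
  -- 2), (4, 1), (6, 0), so these finitely many inequalities suffice.
  have hweights : ∀ v w S : ℕ, S ≤ 3 * w → S ≤ 2 * v + 2 * w → v ≤ w →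
      (taylorCoefficient φ (4, 0) = 0 ∨ S ≤ 4 * v) →
      (taylorCoefficient φ (3, 1) = 0 ∨ S ≤ 3 * v + w) →
      (taylorCoefficient φ (5, 0) = 0 ∨ S ≤ 5 * v) → S ≤ 6 * v → S ≤ 4 * v + w →
      WeightedOrderGE v w S φ := by
    intro v w S h1 h2 hvw c40 c31 c50 h6 h41 i j hij
    by_contra hne
    rcases j with _ | _ | _ | j
    · rcases Nat.lt_or_ge i 6 with h | h
      · interval_cases i
        · exact hne (hord _ _ (by norm_num))
        · exact hne (hord _ _ (by norm_num))
        · exact hne (hord _ _ (by norm_num))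
        · exact hne h30
        · rcases c40 with c | c
          · exact hne c
          · omega
        · rcases c50 with c | c
          · exact hne c
          · omega
      · have := Nat.mul_le_mul_left v h
        omega
    · rcases Nat.lt_or_ge i 4 with h | h
      · interval_cases i
        · exact hne (hord _ _ (by norm_num))
        · exact hne (hord _ _ (by norm_num))
        · exact hne h21
        · rcases c31 with c | c
          · exact hne c
          · omega
      · have := Nat.mul_le_mul_left v h
        omega
    · rcases Nat.lt_or_ge i 2 with h | h
      · interval_cases i
        · exact hne (hord _ _ (by norm_num))
        · exact hne h12
      · have := Nat.mul_le_mul_left v h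
        omega
    · have := Nat.mul_le_mul_left w (show 3 ≤ j + 1 + 1 + 1 by omega)
      have : 0 ≤ v * i := Nat.zero_le _
      omega
  -- The line through (0, 3) and (i, j) gives the lower bound D = S/(v + w); both points persist
  -- after every change preserving the first axis to first order, so D is an upper bound too.
  have hadapted : ∀ i j v w S : ℕ, ∀ D : ℝ, j ≤ i → 3 * w = S → v * i + w * j = S → 0 < v + w →
      D * (v + w) = S → 3 / 2 ≤ D → WeightedOrderGE v w S φ →
      (∀ {Φ : ℝ × ℝ → ℝ × ℝ}, ContDiff ℝ ∞ Φ → Φ 0 = 0 → ∀ {a b d : ℝ},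
        (∀ x y, fderiv ℝ Φ 0 (x, y) = (a * x + b * y, 0 * x + d * y)) → a ≠ 0 → d ≠ 0 →
        taylorCoefficient (φ ∘ Φ) (i, j) ≠ 0) →
      newtonDistance (φ ∘ Φ) ≤ newtonDistance φ := by
    intro i j v w S D hji h3w hvi hvw hD hD32 hwt hne
    refine le_trans ?_ (le_newtonDistance hwt hvw hD.le)
    refine newtonDistance_comp_le_of_cubic hφ hord h30 h21 (Or.inr h03) hD32
      (fun Φ hΦ hΦ0 hbij hc => ?_) hΦ hΦ0 hbij
    obtain ⟨a, b, c, d, hL, hdet⟩ := exists_matrix_of_bijective hbij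
    obtain rfl : c = 0 := by simpa [hL] using hc
    rw [mul_zero, sub_zero] at hdet
    have h03' : taylorCoefficient (φ ∘ Φ) (0, 3) ≠ 0 := by
      have := (hord.comp hφ hΦ hΦ0).2 (0, 1)
      rw [hL, homogeneousPart_three, homogeneousPart_three, h30, h21, h12] at this
      have e : taylorCoefficient (φ ∘ Φ) (0, 3) = taylorCoefficient φ (0, 3) * d ^ 3 := by
        linear_combination this
      rw [e]
      exact mul_ne_zero h03 (pow_ne_zero _ (right_ne_zero_of_mul hdet))
    exact newtonDistance_le h03' (hne hΦ hΦ0 hL (left_ne_zero_of_mul hdet)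
      (right_ne_zero_of_mul hdet)) (by omega) hji (v := v) (w := w) (S := S) (by omega) (by omega)
      hvw hD.ge
  -- The lines from (0, 3) to (4, 0), (3, 1) and (5, 0), for E₆, E₇ and E₈, give the distances 12/7,
  -- 9/5 and 15/8. If all three coefficients vanish, the weights (1, 2) with S = 6 give at least 2.
  by_cases h40 : taylorCoefficient φ (4, 0) = 0
  · by_cases h31 : taylorCoefficient φ (3, 1) = 0
    · by_cases h50 : taylorCoefficient φ (5, 0) = 0
      · have := le_newtonDistance (D := 2) (hweights 1 2 6 (by norm_num) (by norm_num)
          (by norm_num) (Or.inl h40) (Or.inl h31) (Or.inl h50) (by norm_num) (by norm_num))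
          (by norm_num) (by norm_num)
        rw [ENNReal.ofReal_ofNat] at this
        exact absurd hd2 this.not_gt
      · exact hadapted 5 0 3 5 15 (15 / 8) (by norm_num) (by norm_num) (by norm_num) (by norm_num)
          (by norm_num) (by norm_num) (hweights _ _ _ (by norm_num) (by norm_num) (by norm_num)
          (Or.inl h40) (Or.inl h31) (Or.inr (by norm_num)) (by norm_num) (by norm_num))
          fun hΦ hΦ0 _ _ _ hL ha hd => (taylorCoefficient_comp_ne_zero_of_cube hφ hord h30 h21 h12
            hΦ hΦ0 hL ha hd).2.2 h40 h31 h50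
    · exact hadapted 3 1 2 3 9 (9 / 5) (by norm_num) (by norm_num) (by norm_num) (by norm_num)
        (by norm_num) (by norm_num) (hweights _ _ _ (by norm_num) (by norm_num) (by norm_num)
        (Or.inl h40) (Or.inr (by norm_num)) (Or.inr (by norm_num)) (by norm_num) (by norm_num))
        fun hΦ hΦ0 _ _ _ hL ha hd => (taylorCoefficient_comp_ne_zero_of_cube hφ hord h30 h21 h12
          hΦ hΦ0 hL ha hd).2.1 h40 h31
  · exact hadapted 4 0 3 4 12 (12 / 7) (by norm_num) (by norm_num) (by norm_num) (by norm_num)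
      (by norm_num) (by norm_num) (hweights _ _ _ (by norm_num) (by norm_num) (by norm_num)
      (Or.inr (by norm_num)) (Or.inr (by norm_num)) (Or.inr (by norm_num)) (by norm_num)
      (by norm_num))
      fun hΦ hΦ0 _ _ _ hL ha hd => (taylorCoefficient_comp_ne_zero_of_cube hφ hord h30 h21 h12
        hΦ hΦ0 hL ha hd).1 h40

/-! ### Completing the square -/

/-- Modulo x₁² the expression is just x₂², which explains the restriction to `i ≤ 1`. -/
lemma taylorCoefficient_sq_sub {χ : ℝ → ℝ} (hχ : ContDiff ℝ ∞ χ) {i : ℕ} (hi : i ≤ 1) (j : ℕ) :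
    taylorCoefficient (fun p : ℝ × ℝ => (p.2 - p.1 ^ 2 * χ p.1) ^ 2) (i, j) =
      if i = 0 ∧ j = 2 then 1 else 0 := by
  have h1 : ∀ x y : ℝ, (y - x ^ 2 * χ x) ^ 2 =
      x ^ 2 * (x ^ 2 * χ x ^ 2) + y * (y - x ^ 2 * (2 * χ x)) := fun x y => by ring
  have h2 : ∀ x y : ℝ, y - x ^ 2 * (2 * χ x) = x ^ 2 * (-2 * χ x) + y * 1 := fun x y => by ring
  have hs1 : ContDiff ℝ ∞ fun p : ℝ × ℝ => p.2 - p.1 ^ 2 * (2 * χ p.1) :=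
    contDiff_snd.sub ((contDiff_fst.pow 2).mul (contDiff_const.mul (hχ.comp contDiff_fst)))
  rcases j with _ | _ | j
  · rw [if_neg (by omega), taylorCoefficient_zero_right]
    have : (fun x : ℝ => ((x, (0 : ℝ)).2 - (x, (0 : ℝ)).1 ^ 2 * χ (x, (0 : ℝ)).1) ^ 2) =
        fun x => x ^ 2 * (x ^ 2 * χ x ^ 2) := by ext x; simp only; ring
    rw [this, taylorCoeff_pow_mul_of_lt (by fun_prop) (by omega)]
  · rw [if_neg (by omega), taylorCoefficient_snd_succ hs1 h1, taylorCoefficient_zero_right]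
    have : (fun x : ℝ => (x, (0 : ℝ)).2 - (x, (0 : ℝ)).1 ^ 2 * (2 * χ (x, (0 : ℝ)).1)) =
        fun x => x ^ 2 * (-2 * χ x) := by ext x; simp only; ring
    rw [this, taylorCoeff_pow_mul_of_lt (by fun_prop) (by omega)]
  · rw [taylorCoefficient_snd_succ hs1 h1,
      taylorCoefficient_snd_succ (h := fun _ => 1) contDiff_const h2]
    have := taylorCoefficient_comp_fst (fun _ => 1) i j
    rw [this]
    rcases i with _ | i
    · simp
    · rw [taylorCoeff_const_succ, ite_self]
      simp

/-- Used to read off low coefficients of b from those of φ after the square has been completed. -/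
lemma taylorCoefficient_mul_sq_sub {b : ℝ × ℝ → ℝ} {χ : ℝ → ℝ} (hb : ContDiff ℝ ∞ b)
    (hχ : ContDiff ℝ ∞ χ) {i : ℕ} (hi : i ≤ 1) (j : ℕ) :
    taylorCoefficient (fun p : ℝ × ℝ => b p * (p.2 - p.1 ^ 2 * χ p.1) ^ 2) (i, j + 2) =
      taylorCoefficient b (i, j) := by
  have hs : ContDiff ℝ ∞ fun p : ℝ × ℝ => (p.2 - p.1 ^ 2 * χ p.1) ^ 2 :=
    (contDiff_snd.sub ((contDiff_fst.pow 2).mul (hχ.comp contDiff_fst))).pow 2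
  rw [taylorCoefficient_mul hb hs, Finset.sum_eq_single (j, 2), Finset.sum_eq_single (i, 0)]
  · rw [taylorCoefficient_sq_sub hχ (by norm_num)]; simp
  · rintro ⟨p, q⟩ hpq hne
    rw [Finset.HasAntidiagonal.mem_antidiagonal] at hpq
    simp only at hpq
    rw [taylorCoefficient_sq_sub hχ (by simp only; omega), if_neg, mul_zero]
    rintro ⟨h, -⟩
    simp only at h
    exact hne (by rw [Prod.mk.injEq]; omega)
  · simp
  · rintro ⟨p, q⟩ hpq hne
    rw [Finset.HasAntidiagonal.mem_antidiagonal] at hpq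
    simp only at hpq
    refine Finset.sum_eq_zero ?_
    rintro ⟨r, s⟩ hrs
    rw [Finset.HasAntidiagonal.mem_antidiagonal] at hrs
    simp only at hrs
    rw [taylorCoefficient_sq_sub hχ (by simp only; omega), if_neg, mul_zero]
    rintro ⟨-, h⟩
    simp only at h
    exact hne (by rw [Prod.mk.injEq]; omega)
  · simp

/-- If the lowest homogeneous part of `φ` is `a * x₁ ^ l * x₂ ^ 2` with `a ≠ 0`, then one can
complete the square in `x₂`. -/
lemma exists_square_completion {φ : ℝ × ℝ → ℝ} (hφ : ContDiff ℝ ∞ φ) {l : ℕ}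
    (hord : WeightedOrderGE 1 1 (l + 2) φ) (hl : taylorCoefficient φ (l, 2) ≠ 0)
    (hne : ∀ i ≤ l + 2, i ≠ l → taylorCoefficient φ (i, l + 2 - i) = 0) :
    ∃ (b : ℝ × ℝ → ℝ) (χ v : ℝ → ℝ), ContDiff ℝ ∞ b ∧ ContDiff ℝ ∞ χ ∧ ContDiff ℝ ∞ v ∧
      ∀ᶠ p in 𝓝 (0 : ℝ × ℝ),
        φ p = b p * (p.2 - p.1 ^ 2 * χ p.1) ^ 2 + p.1 ^ (l + 3) * v p.1 := by
  obtain ⟨A, hA, hφA, hA0⟩ := exists_homogeneous_decomposition hφ hord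
  -- Blow-up x₂ = x₁u: φ = x₁^(l+2) E(x₁, u) with E(0, u) = a u². The critical point of E in u is
  -- nondegenerate even when l = 1, where ∂₂²φ vanishes at the origin.
  let E : ℝ × ℝ → ℝ := fun q =>
    ∑ i ∈ Finset.range (l + 2 + 1), A i (q.1, q.1 * q.2) * q.2 ^ (l + 2 - i)
  have hE : ContDiff ℝ ∞ E := ContDiff.sum fun i _ =>
    ((hA i).comp (by fun_prop)).mul (contDiff_snd.pow _)
  have hφE : ∀ x u, φ (x, x * u) = x ^ (l + 2) * E (x, u) := fun x u => by
    rw [hφA, Finset.mul_sum]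
    refine Finset.sum_congr rfl fun i hi => ?_
    have hi : i ≤ l + 2 := Nat.lt_succ_iff.1 (Finset.mem_range.1 hi)
    simp only
    rw [mul_pow]
    nth_rewrite 3 [← Nat.add_sub_cancel' hi]
    rw [pow_add]; ring
  have hE0 : ∀ u, E (0, u) = taylorCoefficient φ (l, 2) * u ^ 2 := fun u => by
    simp only [E, zero_mul]
    rw [Finset.sum_eq_single l]
    · have := hA0 l (by omega)
      rw [Nat.add_sub_cancel_left] at this ⊢
      rw [← this]; rfl
    · intro i hi hil
      have hi : i ≤ l + 2 := Nat.lt_succ_iff.1 (Finset.mem_range.1 hi)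
      have := hA0 i hi
      rw [hne i hi hil] at this
      have h0 : A i (0, 0) = 0 := this
      rw [h0, zero_mul]
    · intro h
      exact absurd (Finset.mem_range.2 (by omega)) h
  let G : ℝ × ℝ → ℝ := fun q => fderiv ℝ E q (0, 1)
  have hG : ContDiff ℝ ∞ G := (hE.fderiv_right (m := ∞) le_rfl).clm_apply contDiff_const
  have hpartial : ∀ (h : ℝ × ℝ → ℝ), ContDiff ℝ ∞ h → ∀ x u,
      HasDerivAt (fun u => h (x, u)) (fderiv ℝ h (x, u) (0, 1)) u := fun h hh x u =>
    (hh.differentiable (by simp) (x, u)).hasFDerivAt.comp_hasDerivAt (f := fun u : ℝ => (x, u)) u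
      ((hasDerivAt_const _ x).prodMk (hasDerivAt_id u))
  have hG0 : ∀ u, G (0, u) = 2 * taylorCoefficient φ (l, 2) * u := fun u => by
    have h1 : HasDerivAt (fun u => E (0, u)) (G (0, u)) u := hpartial E hE 0 u
    have h2 : HasDerivAt (fun u => E (0, u)) (taylorCoefficient φ (l, 2) * (2 * u)) u := by
      rw [funext hE0]
      simpa using (hasDerivAt_pow 2 u).const_mul (taylorCoefficient φ (l, 2))
    rw [h1.unique h2]; ring
  obtain ⟨η, hη, hη0, hGη⟩ := exists_smooth_implicit hG
    (by have := hG0 0; rwa [mul_zero] at this) (by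
      have h1 : HasDerivAt (fun u => G (0, u)) (fderiv ℝ G (0, 0) (0, 1)) 0 := hpartial G hG 0 0
      have h2 : HasDerivAt (fun u => G (0, u)) (2 * taylorCoefficient φ (l, 2)) 0 := by
        rw [funext hG0]
        simpa using (hasDerivAt_id (0 : ℝ)).const_mul (2 * taylorCoefficient φ (l, 2))
      have h3 : fderiv ℝ G 0 (0, 1) = 2 * taylorCoefficient φ (l, 2) := h1.unique h2
      rw [h3]
      exact mul_ne_zero two_ne_zero hl)
  obtain ⟨χ, hχ, hηχ⟩ := exists_eq_add_mul hη
  replace hηχ : ∀ x, η x = x * χ x := fun x => by rw [hηχ, hη0, zero_add]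
  have hψ : ∀ x, x * η x = x ^ 2 * χ x := fun x => by rw [hηχ]; ring
  -- The chain rule carries ∂ᵤE = 0 over to ∂₂φ = 0 only where x ≠ 0; at x = 0 the order of φ is
  -- used.
  have hcrit : ∀ᶠ x in 𝓝 (0 : ℝ), fderiv ℝ φ (x, x ^ 2 * χ x) (0, 1) = 0 := by
    filter_upwards [hGη] with x hx
    rcases eq_or_ne x 0 with rfl | hx0
    · have h1 : HasDerivAt (fun u => φ (0, u)) (fderiv ℝ φ (0, 0) (0, 1)) 0 := hpartial φ hφ 0 0
      have h2 := hord 0 1 (by omega)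
      rw [taylorCoefficient_zero_left, taylorCoeff_one, h1.deriv] at h2
      simpa using h2
    · have h1 : HasDerivAt (fun u => φ (x, x * u)) (fderiv ℝ φ (x, x * η x) (0, 1) * x) (η x) := by
        have := (hpartial φ hφ x (x * η x)).comp (η x) ((hasDerivAt_id (η x)).const_mul x)
        simpa using! this
      have h2 : HasDerivAt (fun u => φ (x, x * u)) (x ^ (l + 2) * G (x, η x)) (η x) := by
        rw [funext (hφE x)]
        exact (hpartial E hE x (η x)).const_mul _
      have h3 := h1.unique h2
      rw [hx, mul_zero, hψ] at h3
      exact (mul_eq_zero.1 h3).resolve_right hx0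
  -- Two applications of Hadamard's lemma about the critical curve leave no linear term, and the
  -- second quotient gives b.
  have hshift : ContDiff ℝ ∞ fun q : ℝ × ℝ => φ (q.1, q.1 ^ 2 * χ q.1 + q.2) :=
    hφ.comp (contDiff_fst.prodMk (((contDiff_fst.pow 2).mul (hχ.comp contDiff_fst)).add contDiff_snd))
  obtain ⟨K, hK, hφK⟩ := exists_eq_add_snd_mul hshift
  obtain ⟨B, hB, hKB⟩ := exists_eq_add_snd_mul hK
  simp only at hφK
  have hK0 : ∀ x, K (x, 0) = fderiv ℝ φ (x, x ^ 2 * χ x) (0, 1) := fun x => by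
    have h1 : HasDerivAt (fun z => φ (x, x ^ 2 * χ x + z))
        (fderiv ℝ φ (x, x ^ 2 * χ x + 0) (0, 1)) 0 := (hpartial φ hφ x _).comp_const_add _ _
    have h2 : HasDerivAt (fun z => φ (x, x ^ 2 * χ x + z)) (K (x, 0)) 0 := by
      have := ((hasDerivAt_id (0 : ℝ)).mul ((hK.comp (by fun_prop : ContDiff ℝ ∞ fun z : ℝ =>
        (x, z))).differentiable (by simp) 0).hasDerivAt).const_add (φ (x, x ^ 2 * χ x + 0))
      rw [funext (hφK x)]
      simpa using! this
    rw [h2.unique h1, add_zero]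
  -- E(x, η(x)) vanishes at x = 0, which gives the remainder one power of x₁ more than l + 2.
  obtain ⟨v, hv, hφv, -⟩ := exists_eq_pow_mul (f := fun x => E (x, η x))
    (hE.comp (contDiff_id.prodMk hη)) (k := 1) fun j hj => by
      obtain rfl : j = 0 := by omega
      rw [taylorCoeff_zero, hη0, hE0]; ring
  refine ⟨fun p => B (p.1, p.2 - p.1 ^ 2 * χ p.1), χ, v, hB.comp (contDiff_fst.prodMk
    (contDiff_snd.sub ((contDiff_fst.pow 2).mul (hχ.comp contDiff_fst)))), hχ, hv, ?_⟩
  filter_upwards [(continuous_fst.tendsto (0 : ℝ × ℝ)).eventually hcrit] with p hp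
  obtain ⟨x, y⟩ := p
  simp only at hp ⊢
  have h1 := hφK x (y - x ^ 2 * χ x)
  rw [hKB, hK0, hp, add_sub_cancel, add_zero] at h1
  rw [h1, ← hψ, hφE, hφv]
  ring

/-! ### Newton distances of the normal forms -/

/-- If the linear part moves the first axis, the lowest homogeneous part already bounds the distance
by 1 or 3/2. Otherwise the pullback is again a square term plus an n-th power, with g = Φ₂ − ψ(Φ₁)
still tangent to the first axis, and `newtonDistance_le_of_square_add` applies. -/
lemma newtonDistance_comp_le_of_normalForm {φ b : ℝ × ℝ → ℝ} {χ β : ℝ → ℝ} {l n : ℕ}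
    (hφ : ContDiff ℝ ∞ φ) (hb : ContDiff ℝ ∞ b) (hχ : ContDiff ℝ ∞ χ) (hβ : ContDiff ℝ ∞ β)
    (hl1 : l ≤ 1) (hord : WeightedOrderGE 1 1 (l + 2) φ) (hl : taylorCoefficient φ (l, 2) ≠ 0)
    (hne : ∀ i ≤ l + 2, i ≠ l → taylorCoefficient φ (i, l + 2 - i) = 0)
    (hbord : WeightedOrderGE 1 1 l b) (hbl : taylorCoefficient b (l, 0) ≠ 0) (hβ0 : β 0 ≠ 0)
    (hn : l + 3 ≤ n)
    (heq : ∀ᶠ p in 𝓝 (0 : ℝ × ℝ),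
      φ p = b p * (p.2 - p.1 ^ 2 * χ p.1) ^ 2 + p.1 ^ n * β p.1) {D : ℝ}
    (hD : 2 * n ≤ D * (2 + (n - l))) {Φ : ℝ × ℝ → ℝ × ℝ} (hΦ : ContDiff ℝ ∞ Φ) (hΦ0 : Φ 0 = 0)
    (hbij : Function.Bijective (fderiv ℝ Φ 0)) :
    newtonDistance (φ ∘ Φ) ≤ ENNReal.ofReal D := by
  have hn' : (l : ℝ) + 3 ≤ n := by exact_mod_cast hn
  have main : ∀ Φ : ℝ × ℝ → ℝ × ℝ, ContDiff ℝ ∞ Φ → Φ 0 = 0 →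
      Function.Bijective (fderiv ℝ Φ 0) → (fderiv ℝ Φ 0 (1, 0)).2 = 0 →
      (∀ a b d : ℝ, (∀ x y, fderiv ℝ Φ 0 (x, y) = (a * x + b * y, 0 * x + d * y)) → a ≠ 0 →
        d ≠ 0 → taylorCoefficient (φ ∘ Φ) (l, 2) ≠ 0) →
      newtonDistance (φ ∘ Φ) ≤ ENNReal.ofReal D := by
    intro Φ hΦ hΦ0 hbij hc hcoef
    obtain ⟨a, e, c, d, hL, hdet⟩ := exists_matrix_of_bijective hbij
    obtain rfl : c = 0 := by simpa [hL] using hc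
    rw [mul_zero, sub_zero] at hdet
    have ha := left_ne_zero_of_mul hdet
    have hd := right_ne_zero_of_mul hdet
    obtain ⟨hdx, hfx, hgx, hfy, hgy⟩ := components_of_axis hΦ hL
    have hΦ00 : Φ (0, 0) = (0, 0) := hΦ0
    let f : ℝ × ℝ → ℝ := fun p => (Φ p).1
    let g : ℝ × ℝ → ℝ := fun p => (Φ p).2 - (Φ p).1 ^ 2 * χ (Φ p).1
    have hf : ContDiff ℝ ∞ f := contDiff_fst.comp hΦ
    have hg : ContDiff ℝ ∞ g := (contDiff_snd.comp hΦ).sub ((hf.pow 2).mul (hχ.comp hf))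
    obtain ⟨v, hv, hbv, hv0⟩ := exists_comp_curve_eq_pow_mul hb hbord
      (γ := fun s => Φ (s, 0)) (hΦ.comp (by fun_prop)) hΦ0
    -- On the image of the first axis only the monomial x₁^l of b contributes to leading order, with
    -- coefficient a^l times that of b.
    have hv0' : v 0 ≠ 0 := by
      rw [hv0, hdx.deriv, homogeneousPart, Finset.sum_eq_single l]
      · simpa using ⟨hbl, fun h => absurd h ha⟩
      · intro i hi hil
        have := Finset.mem_range.1 hi
        rw [zero_pow (by omega), mul_zero, mul_zero]
      · simp
    have hΦ_tendsto : Tendsto Φ (𝓝 0) (𝓝 0) := by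
      have := hΦ.continuous.tendsto 0
      rwa [hΦ0] at this
    have hF : (φ ∘ Φ) =ᶠ[𝓝 0] fun p => (b ∘ Φ) p * g p ^ 2 + f p ^ n * β (f p) :=
      hΦ_tendsto.eventually heq
    have hsq : ∀ {γ : ℝ → ℝ}, ContDiff ℝ ∞ γ → γ 0 = 0 →
        HasDerivAt (fun s => γ s ^ 2 * χ (γ s)) 0 0 := by
      intro γ hγ hγ0
      have h1 := ((hγ.differentiable (by simp) 0).hasDerivAt.pow 2).mul
        ((hχ.comp hγ).differentiable (by simp) 0).hasDerivAt
      simpa [hγ0] using! h1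
    have hder : ∀ {δ : ℝ → ℝ × ℝ}, ContDiff ℝ ∞ δ → Φ (δ 0) = 0 →
        deriv (fun s => g (δ s)) 0 = deriv (fun s => (Φ (δ s)).2) 0 := by
      intro δ hδ hδ0
      have h1 := (((contDiff_snd.comp hΦ).comp hδ).differentiable (by simp) 0).hasDerivAt.sub
        (hsq (hf.comp hδ) (by simp [f, hδ0]))
      rw [sub_zero] at h1
      exact h1.deriv
    rw [newtonDistance_congr hF]
    refine newtonDistance_le_of_square_add (hb.comp hΦ) hf hg hv hβ hl1 hbv hv0' hβ0
      (by simp [f, hΦ00]) (by simp [g, hΦ00]) (by rw [hfx]; exact ha) ?_ ?_ (by omega) ?_ hD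
    · rw [hder (δ := fun s => (s, 0)) (by fun_prop) hΦ0, hgx]
    · rw [hder (δ := fun s => (0, s)) (by fun_prop) hΦ0, hgy]
      exact hd
    · rw [← taylorCoefficient_congr hF]
      exact hcoef a e d hL ha hd
  obtain rfl | rfl : l = 0 ∨ l = 1 := by omega
  · have h20 := hne 2 le_rfl (by norm_num)
    have h11 := hne 1 (by norm_num) (by norm_num)
    -- 2n ≤ D(n + 2) with n ≥ 3 even forces D ≥ 6/5.
    have hD1 : 1 ≤ D := by
      by_contra hlt
      push_cast at hD hn'
      nlinarith
    refine newtonDistance_comp_le_of_quadratic hφ hord h20 h11 hl hD1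
      (fun Φ hΦ hΦ0 hbij hc => main Φ hΦ hΦ0 hbij hc fun a e d hL ha hd => ?_) hΦ hΦ0 hbij
    have := (hord.comp hφ hΦ hΦ0).2 (0, 1)
    rw [hL] at this
    simp only [zero_add, homogeneousPart_two, h20, h11] at this
    have e : taylorCoefficient (φ ∘ Φ) (0, 2) = taylorCoefficient φ (0, 2) * d ^ 2 := by
      linear_combination this
    rw [e]
    exact mul_ne_zero hl (pow_ne_zero _ hd)
  · have h30 := hne 3 le_rfl (by norm_num)
    have h21 := hne 2 (by norm_num) (by norm_num)
    have h03 := hne 0 (by norm_num) (by norm_num)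
    -- 2n ≤ D(n + 1) with n ≥ 4 forces D ≥ 8/5.
    have hD1 : 3 / 2 ≤ D := by
      by_contra hlt
      push_cast at hD hn'
      nlinarith
    refine newtonDistance_comp_le_of_cubic hφ hord h30 h21 (Or.inl hl) hD1
      (fun Φ hΦ hΦ0 hbij hc => main Φ hΦ hΦ0 hbij hc fun a e d hL ha hd => ?_) hΦ hΦ0 hbij
    have key : ∀ y : ℝ × ℝ, homogeneousPart (φ ∘ Φ) 3 y =
        homogeneousPart φ 3 (fderiv ℝ Φ 0 y) := (hord.comp hφ hΦ hΦ0).2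
    have k1 := key (1, 1)
    have k2 := key (1, -1)
    have k3 := key (1, 0)
    rw [hL] at k1 k2 k3
    simp only [homogeneousPart_three, h30, h21] at k1 k2 k3
    norm_num [show taylorCoefficient φ (0, 3) = 0 from h03] at k1 k2 k3
    have e : taylorCoefficient (φ ∘ Φ) (1, 2) = taylorCoefficient φ (1, 2) * a * d ^ 2 := by
      linear_combination (k1 + k2) / 2 - k3
    rw [e]
    exact mul_ne_zero (mul_ne_zero hl ha) (pow_ne_zero _ hd)

/-- Weighted orders add under multiplication: S from b, and w from each factor x₂ − ψ(x₁). -/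
lemma weightedOrderGE_of_normalForm {φ b : ℝ × ℝ → ℝ} {ψ b₀ : ℝ → ℝ} {v w S T : ℕ}
    (hb : ContDiff ℝ ∞ b) (hψ : ContDiff ℝ ∞ ψ) (hb₀ : ContDiff ℝ ∞ b₀)
    (heq : ∀ᶠ p in 𝓝 (0 : ℝ × ℝ), φ p = b p * (p.2 - ψ p.1) ^ 2 + b₀ p.1)
    (hbS : WeightedOrderGE v w S b) (hψw : ∀ i, v * i < w → taylorCoeff ψ i = 0)
    (hT : T = S + (w + w)) (hb₀T : ∀ i, v * i < T → taylorCoeff b₀ i = 0) :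
    WeightedOrderGE v w T φ := by
  have hψ1 : ContDiff ℝ ∞ fun p : ℝ × ℝ => p.2 - ψ p.1 :=
    contDiff_snd.sub (hψ.comp contDiff_fst)
  have hz : WeightedOrderGE v w w fun p : ℝ × ℝ => p.2 - ψ p.1 := by
    intro i j hij
    rcases j with _ | j
    · rw [taylorCoefficient_zero_right]
      have : (fun x : ℝ => (x, (0 : ℝ)).2 - ψ (x, (0 : ℝ)).1) = fun x => (-1) * ψ x := by
        ext x; simp
      rw [this, taylorCoeff_const_mul, hψw i (by omega), mul_zero]
    · rw [Nat.mul_succ] at hij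
      omega
  have h0 : WeightedOrderGE v w T fun p : ℝ × ℝ => b₀ p.1 := by
    intro i j hij
    rw [taylorCoefficient_comp_fst]
    split_ifs with h
    · exact hb₀T i (by rw [h] at hij; omega)
    · rfl
  have hmul := hbS.mul (hz.mul hz hψ1 hψ1) hb (hψ1.mul hψ1)
  rw [← hT] at hmul
  refine (hmul.add h0 (hb.mul (hψ1.mul hψ1)) (hb₀.comp contDiff_fst)).congr ?_
  filter_upwards [heq] with p hp
  rw [hp]; ring

/-- `φ` has a normal form of type `A` or `D` in the given coordinates. -/
def HasNormalForm (φ : ℝ × ℝ → ℝ) : Prop :=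
  ∃ (b : ℝ × ℝ → ℝ) (ψ b₀ : ℝ → ℝ) (m : ℕ) (c : ℝ),
    SmoothNearZero b ∧ SmoothNearZero ψ ∧ SmoothNearZero b₀ ∧
    (∀ᶠ x in 𝓝 (0 : ℝ × ℝ), φ x = b x * (x.2 - ψ x.1) ^ 2 + b₀ x.1) ∧
    2 ≤ m ∧ c ≠ 0 ∧
    (fun s : ℝ => ψ s - c * s ^ m) =O[𝓝 0] (fun s : ℝ => s ^ (m + 1)) ∧
    ((b 0 ≠ 0 ∧ IsFlatOrHasOrderAtLeast b₀ (2 * m + 1)) ∨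
      (b 0 = 0 ∧
        (∃ (b₁ : ℝ × ℝ → ℝ) (b₂ : ℝ → ℝ),
          SmoothNearZero b₁ ∧ SmoothNearZero b₂ ∧ b₁ 0 ≠ 0 ∧
          ∀ᶠ x in 𝓝 (0 : ℝ × ℝ), b x = x.1 * b₁ x + x.2 ^ 2 * b₂ x.2) ∧
        IsFlatOrHasOrderAtLeast b₀ (2 * m + 2)))

/-- If the lowest homogeneous part of `φ` is `a * x₁ ^ l * x₂ ^ 2` with `a ≠ 0` and `l ≤ 1`, and
the given coordinates are not adapted, then `φ` has the normal form of type `A` or `D`. -/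
lemma exists_normalForm {φ : ℝ × ℝ → ℝ} {l : ℕ} (hφ : ContDiff ℝ ∞ φ)
    (hl1 : l ≤ 1) (hord : WeightedOrderGE 1 1 (l + 2) φ) (hl : taylorCoefficient φ (l, 2) ≠ 0)
    (hne : ∀ i ≤ l + 2, i ≠ l → taylorCoefficient φ (i, l + 2 - i) = 0)
    (hd2 : newtonDistance φ < 2) {Φ : ℝ × ℝ → ℝ × ℝ} (hΦ : ContDiff ℝ ∞ Φ) (hΦ0 : Φ 0 = 0)
    (hbij : Function.Bijective (fderiv ℝ Φ 0))
    (hΦd : newtonDistance φ < newtonDistance (φ ∘ Φ)) :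
    HasNormalForm φ := by
  obtain ⟨b, χ, v, hb, hχ, hv, heq⟩ := exists_square_completion hφ hord hl hne
  have hcoef : ∀ i ≤ 1, ∀ j, taylorCoefficient b (i, j) = taylorCoefficient φ (i, j + 2) := by
    intro i hi j
    rw [taylorCoefficient_congr heq, taylorCoefficient_add (f := fun p : ℝ × ℝ =>
      b p * (p.2 - p.1 ^ 2 * χ p.1) ^ 2) (g := fun p : ℝ × ℝ => p.1 ^ (l + 3) * v p.1)
      (hb.mul ((contDiff_snd.sub ((contDiff_fst.pow 2).mul (hχ.comp contDiff_fst))).pow 2))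
      ((contDiff_fst.pow _).mul (hv.comp contDiff_fst)), taylorCoefficient_mul_sq_sub hb hχ hi,
      taylorCoefficient_comp_fst (fun x => x ^ (l + 3) * v x), if_neg (by omega), add_zero]
  have hbord : WeightedOrderGE 1 1 l b := fun i j hij => by
    rw [hcoef i (by omega), hord _ _ (by omega)]
  have hbl : taylorCoefficient b (l, 0) ≠ 0 := by rwa [hcoef l hl1]
  set ψ : ℝ → ℝ := fun x => x ^ 2 * χ x with hψ_def
  set b₀ : ℝ → ℝ := fun x => x ^ (l + 3) * v x with hb₀_def
  have hψ : ContDiff ℝ ∞ ψ := (contDiff_id.pow 2).mul hχ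
  have hb₀ : ContDiff ℝ ∞ b₀ := (contDiff_id.pow _).mul hv
  have hψ_low : ∀ i < 2, taylorCoeff ψ i = 0 := fun i hi => taylorCoeff_pow_mul_of_lt hχ hi
  have hb₀_low : ∀ i < l + 3, taylorCoeff b₀ i = 0 := fun i hi => taylorCoeff_pow_mul_of_lt hv hi
  have heq' : ∀ᶠ p in 𝓝 (0 : ℝ × ℝ), φ p = b p * (p.2 - ψ p.1) ^ 2 + b₀ p.1 := heq
  -- The threshold 2m + 1 + l covers both types at once.
  have hfinish : ∀ (m : ℕ) (u : ℝ → ℝ), ContDiff ℝ ∞ u → u 0 ≠ 0 → (∀ x, ψ x = x ^ m * u x) →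
      IsFlatOrHasOrderAtLeast b₀ (2 * m + 1 + l) → HasNormalForm φ := by
    intro m u hu hu0 hψu hflat
    have hm : 2 ≤ m := by
      by_contra hlt
      have := hψ_low m (by omega)
      rw [funext hψu, taylorCoeff_pow_mul hu] at this
      exact hu0 this
    refine ⟨b, ψ, b₀, m, u 0, .of_contDiff hb, .of_contDiff hψ, .of_contDiff hb₀, heq', hm, hu0,
      ?_, ?_⟩
    · obtain ⟨u', hu', huu'⟩ := exists_eq_add_mul hu
      have e : (fun s : ℝ => ψ s - u 0 * s ^ m) = fun s => s ^ (m + 1) * u' s := by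
        ext s; rw [hψu, huu']; ring
      have := (isBigO_refl (fun s : ℝ => s ^ (m + 1)) (𝓝 0)).mul
        ((hu'.continuous.continuousAt (x := (0 : ℝ))).isBigO_one ℝ)
      rw [e]
      simpa using this
    · obtain rfl | rfl : l = 0 ∨ l = 1 := by omega
      · exact Or.inl ⟨by simpa using hbl, hflat⟩
      · have hb00 : b 0 = 0 := by
          rw [← taylorCoefficient_zero b]; exact hbord 0 0 (by norm_num)
        refine Or.inr ⟨hb00, ?_, hflat⟩
        obtain ⟨b₁, hb₁, hbb₁⟩ := exists_eq_add_fst_mul hb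
        -- b(0, y) is divisible by y² because its first two coefficients are those of x₂² and x₂³ in
        -- φ, which vanish for l = 1.
        obtain ⟨b₂, hb₂, hbb₂, -⟩ := exists_eq_pow_mul (f := fun y => b (0, y))
          (hb.comp (by fun_prop)) (k := 2) fun j hj => by
            rw [← taylorCoefficient_zero_left, hcoef 0 (by norm_num)]
            rcases j with _ | j
            · exact hord _ _ (by norm_num)
            · obtain rfl : j = 0 := by omega
              exact hne 0 (by norm_num) (by norm_num)
        refine ⟨b₁, b₂, .of_contDiff hb₁, .of_contDiff hb₂, ?_, Eventually.of_forall fun p => ?_⟩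
        · rw [← taylorCoefficient_zero b₁, ← taylorCoefficient_fst_succ hb₁ (a := fun y => b (0, y))
            (hb.comp (by fun_prop)) hbb₁]
          exact hbl
        · obtain ⟨x, y⟩ := p
          rw [hbb₁, hbb₂]
          simp only
          ring
  -- With weights (2, n − l), both x₁^l x₂² and x₁^n have degree 2n, and x₂ − ψ(x₁) has weight n − l
  -- by the assumption on ψ. The resulting lower bound D equals the upper bound valid in all
  -- coordinates.
  have hadapted : ∀ (n : ℕ) (β : ℝ → ℝ), ContDiff ℝ ∞ β → β 0 ≠ 0 → (∀ x, b₀ x = x ^ n * β x) →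
      (∀ i, 2 * i < n - l → taylorCoeff ψ i = 0) → False := by
    intro n β hβ hβ0 hb₀β hψn
    have hn : l + 3 ≤ n := by
      by_contra hlt
      have := hb₀_low n (by omega)
      rw [funext hb₀β, taylorCoeff_pow_mul hβ] at this
      exact hβ0 this
    obtain ⟨p, rfl⟩ := Nat.exists_eq_add_of_le (show l ≤ n by omega)
    rw [Nat.add_sub_cancel_left] at hψn
    set D : ℝ := 2 * (l + p : ℕ) / (2 + p) with hD_def
    have hD : D * (2 + p) = 2 * (l + p : ℕ) := by rw [hD_def]; field_simp
    have hlow : WeightedOrderGE 2 p (2 * (l + p)) φ := by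
      refine weightedOrderGE_of_normalForm (S := 2 * l) hb hψ hb₀ heq' ?_ hψn (by ring) ?_
      · intro i j hij
        refine hbord i j ?_
        rcases j with _ | j
        · omega
        · have := Nat.mul_le_mul_left p (show 1 ≤ j + 1 by omega)
          omega
      · intro i hi
        rw [funext hb₀β, taylorCoeff_pow_mul_of_lt hβ (by omega)]
    have h1 := le_newtonDistance hlow (D := D) (by omega) (by push_cast at hD ⊢; linarith)
    have h2 := newtonDistance_comp_le_of_normalForm (D := D) hφ hb hχ hβ hl1 hord hl hne hbord hbl
      hβ0 hn (by
        filter_upwards [heq'] with q hq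
        rw [hq, hb₀β]) (by push_cast at hD ⊢; linarith) hΦ hΦ0 hbij
    exact absurd hΦd (h2.trans h1).not_gt
  rcases exists_order_or_taylorCoeff_eq_zero hψ with ⟨m, u, hu, hu0, hψu⟩ | hψ0
  · rcases exists_order_or_taylorCoeff_eq_zero hb₀ with ⟨n, β, hβ, hβ0, hb₀β⟩ | hb₀0
    · by_cases hmn : 2 * m + 1 + l ≤ n
      · exact hfinish m u hu hu0 hψu
          (Or.inr ⟨n, β, hmn, .of_contDiff hβ, hβ0, Eventually.of_forall hb₀β⟩)
      -- Now n − l ≤ 2m, so 2i < n − l forces i < m.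
      · refine (hadapted n β hβ hβ0 hb₀β fun i hi => ?_).elim
        rw [funext hψu, taylorCoeff_pow_mul_of_lt hu (by omega)]
    · exact hfinish m u hu hu0 hψu (Or.inl (isFlatAtZero_of_taylorCoeff_eq_zero hb₀ hb₀0))
  · rcases exists_order_or_taylorCoeff_eq_zero hb₀ with ⟨n, β, hβ, hβ0, hb₀β⟩ | hb₀0
    · exact (hadapted n β hβ hβ0 hb₀β fun i _ => hψ0 i).elim
    -- With ψ and b₀ both flat, the Taylor series of φ is divisible by x₂², which the weights (0, 1)
    -- detect.
    · have hlow : WeightedOrderGE 0 1 2 φ :=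
        weightedOrderGE_of_normalForm (S := 0) hb hψ hb₀ heq' (fun i j hij => by omega)
          (fun i _ => hψ0 i) rfl fun i _ => hb₀0 i
      have := le_newtonDistance (D := 2) hlow (by norm_num) (by norm_num)
      rw [ENNReal.ofReal_ofNat] at this
      exact absurd hd2 this.not_gt

/-! ### Linear normalization and the main result -/

/-- The coefficients of degree k + 1 of φ ∘ Φ are those of φ composed with the linear part of Φ, so
an assumption on linear changes carries over to all changes. -/
lemma exists_linear_form_ne_zero {φ : ℝ × ℝ → ℝ} (hφ : ContDiff ℝ ∞ φ) {k : ℕ}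
    (hord : WeightedOrderGE 1 1 (k + 1) φ)
    (hT : ∀ T : (ℝ × ℝ) ≃L[ℝ] (ℝ × ℝ), taylorCoefficient (φ ∘ T) (k + 1, 0) = 0 →
      taylorCoefficient (φ ∘ T) (k, 1) ≠ 0)
    {Φ : ℝ × ℝ → ℝ × ℝ} (hΦ : ContDiff ℝ ∞ Φ) (hΦ0 : Φ 0 = 0)
    (hbij : Function.Bijective (fderiv ℝ Φ 0)) :
    ∃ i j, i + j = k + 1 ∧ j ≤ 1 ∧ taylorCoefficient (φ ∘ Φ) (i, j) ≠ 0 := by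
  let T : (ℝ × ℝ) ≃L[ℝ] (ℝ × ℝ) :=
    (LinearEquiv.ofBijective (fderiv ℝ Φ 0 : ℝ × ℝ →ₗ[ℝ] ℝ × ℝ) hbij).toContinuousLinearEquiv
  have hTL : ∀ y, T y = fderiv ℝ Φ 0 y := fun y => rfl
  have h1 := (hord.comp hφ hΦ hΦ0).2
  have h2 := (hord.comp hφ T.contDiff (map_zero T)).2
  have hco : ∀ i ≤ k + 1, taylorCoefficient (φ ∘ Φ) (i, k + 1 - i) =
      taylorCoefficient (φ ∘ T) (i, k + 1 - i) := by
    intro i hi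
    refine binaryForm_coeff_eq (c := fun i => taylorCoefficient (φ ∘ Φ) (i, k + 1 - i))
      (d := fun i => taylorCoefficient (φ ∘ T) (i, k + 1 - i)) (fun y => ?_) hi
    refine (h1 y).trans (Eq.trans ?_ (h2 y).symm)
    rw [T.fderiv]
    rfl
  by_cases h : taylorCoefficient (φ ∘ T) (k + 1, 0) = 0
  · refine ⟨k, 1, rfl, le_rfl, ?_⟩
    have := hco k (by omega)
    rw [Nat.add_sub_cancel_left] at this
    rw [this]
    exact hT T h
  · refine ⟨k + 1, 0, rfl, by norm_num, ?_⟩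
    have := hco (k + 1) le_rfl
    rw [Nat.sub_self] at this
    rwa [this]

/-- If the given coordinates are not adapted to `φ`, then the lowest homogeneous part of `φ` is
divisible by the square of a linear form. -/
lemma exists_linear_coefficients_eq_zero {φ : ℝ × ℝ → ℝ} (hφ : ContDiff ℝ ∞ φ) {k : ℕ}
    (hk : 1 ≤ k) (hord : WeightedOrderGE 1 1 (k + 1) φ) {Φ : ℝ × ℝ → ℝ × ℝ} (hΦ : ContDiff ℝ ∞ Φ)
    (hΦ0 : Φ 0 = 0) (hbij : Function.Bijective (fderiv ℝ Φ 0))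
    (hΦd : newtonDistance φ < newtonDistance (φ ∘ Φ)) :
    ∃ T : (ℝ × ℝ) ≃L[ℝ] (ℝ × ℝ), taylorCoefficient (φ ∘ T) (k + 1, 0) = 0 ∧
      taylorCoefficient (φ ∘ T) (k, 1) = 0 := by
  by_contra hT
  push Not at hT
  obtain ⟨i, j, hij, hj, hne⟩ := exists_linear_form_ne_zero hφ hord hT hΦ hΦ0 hbij
  -- Interchanging the axes yields a support point on the other side of the bisectrix, with the same
  -- total degree k + 1.
  obtain ⟨i', j', hij', hj', hne'⟩ := exists_linear_form_ne_zero hφ hord hT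
    (Φ := Φ ∘ Prod.swap) (hΦ.comp (contDiff_snd.prodMk contDiff_fst)) hΦ0
    (bijective_fderiv_comp_swap hΦ hbij)
  rw [← Function.comp_assoc, taylorCoefficient_comp_swap (hφ.comp hΦ)] at hne'
  have h1 := newtonDistance_le (v := 1) (w := 1) (S := k + 1) (D := (k + 1 : ℕ) / 2) hne' hne
    (by omega) (by omega) (by omega) (by omega) (by norm_num) (by push_cast; linarith)
  have h2 := le_newtonDistance hord (D := (k + 1 : ℕ) / 2) (by norm_num) (by push_cast; linarith)
  exact absurd hΦd (h1.trans h2).not_gt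

/-- The normal forms for a function which is smooth on the whole plane. -/
lemma exists_normalForm_linear {φ : ℝ × ℝ → ℝ} (hφ : ContDiff ℝ ∞ φ)
    (hord : WeightedOrderGE 1 1 2 φ)
    (hlin : ∀ T : (ℝ × ℝ) ≃L[ℝ] (ℝ × ℝ), newtonDistance (φ ∘ T) < 2)
    (hna : ∀ T : (ℝ × ℝ) ≃L[ℝ] (ℝ × ℝ), ∃ Φ : ℝ × ℝ → ℝ × ℝ, ContDiff ℝ ∞ Φ ∧ Φ 0 = 0 ∧
      Function.Bijective (fderiv ℝ Φ 0) ∧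
      newtonDistance (φ ∘ T) < newtonDistance ((φ ∘ T) ∘ Φ)) :
    ∃ T : (ℝ × ℝ) ≃L[ℝ] (ℝ × ℝ), HasNormalForm (φ ∘ T) := by
  have hsmooth : ∀ T : (ℝ × ℝ) ≃L[ℝ] (ℝ × ℝ), ContDiff ℝ ∞ (φ ∘ T) := fun T => hφ.comp T.contDiff
  have hna' : ∀ S T : (ℝ × ℝ) ≃L[ℝ] (ℝ × ℝ), ∃ Φ : ℝ × ℝ → ℝ × ℝ, ContDiff ℝ ∞ Φ ∧ Φ 0 = 0 ∧
      Function.Bijective (fderiv ℝ Φ 0) ∧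
      newtonDistance ((φ ∘ S) ∘ T) < newtonDistance (((φ ∘ S) ∘ T) ∘ Φ) := fun S T => hna (T.trans S)
  obtain ⟨Φ₁, hΦ₁, hΦ₁0, hbij₁, hd₁⟩ := hna (.refl ℝ _)
  obtain ⟨T, h20, h11⟩ := exists_linear_coefficients_eq_zero (hsmooth (.refl ℝ _)) (k := 1) le_rfl
    hord hΦ₁ hΦ₁0 hbij₁ hd₁
  replace h20 : taylorCoefficient (φ ∘ T) (2, 0) = 0 := h20
  replace h11 : taylorCoefficient (φ ∘ T) (1, 1) = 0 := h11
  have hordT := (hord.comp hφ T.contDiff (map_zero T)).1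
  obtain ⟨Φ₂, hΦ₂, hΦ₂0, hbij₂, hd₂⟩ := hna T
  by_cases h02 : taylorCoefficient (φ ∘ T) (0, 2) = 0
  swap
  · exact ⟨T, exists_normalForm (l := 0) (hsmooth T) (by norm_num) hordT h02 (by
      intro i hi hi0
      interval_cases i
      exacts [absurd rfl hi0, h11, h20]) (hlin T) hΦ₂ hΦ₂0 hbij₂ hd₂⟩
  have hord3 : WeightedOrderGE 1 1 3 (φ ∘ T) := by
    intro i j hij
    rcases Nat.lt_or_ge (i + j) 2 with h | h
    · exact hordT i j (by omega)
    · obtain rfl : j = 2 - i := by omega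
      have : i ≤ 2 := by omega
      interval_cases i
      exacts [h02, h11, h20]
  obtain ⟨S, h30, h21⟩ := exists_linear_coefficients_eq_zero (hsmooth T) (k := 2) (by norm_num)
    hord3 hΦ₂ hΦ₂0 hbij₂ hd₂
  set f : ℝ × ℝ → ℝ := (φ ∘ T) ∘ S with hf_def
  replace h30 : taylorCoefficient f (3, 0) = 0 := h30
  replace h21 : taylorCoefficient f (2, 1) = 0 := h21
  have hf : ContDiff ℝ ∞ f := (hsmooth T).comp S.contDiff
  have hordS : WeightedOrderGE 1 1 3 f := (hord3.comp (hsmooth T) S.contDiff (map_zero S)).1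
  have hfd : newtonDistance f < 2 := hlin (S.trans T)
  obtain ⟨Φ₃, hΦ₃, hΦ₃0, hbij₃, hd₃⟩ := hna' T S
  by_cases h12 : taylorCoefficient f (1, 2) = 0
  · by_cases h03 : taylorCoefficient f (0, 3) = 0
    -- A vanishing cubic part would make the order at least 4, hence the distance at least 2.
    · have hord4 : WeightedOrderGE 1 1 4 f := by
        intro i j hij
        rcases Nat.lt_or_ge (i + j) 3 with h | h
        · exact hordS i j (by omega)
        · obtain rfl : j = 3 - i := by omega
          have : i ≤ 3 := by omega
          interval_cases i
          exacts [h03, h12, h21, h30]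
      have := le_newtonDistance hord4 (D := 2) (by norm_num) (by norm_num)
      rw [ENNReal.ofReal_ofNat] at this
      exact absurd hfd this.not_gt
    · exact absurd hd₃
        (newtonDistance_comp_le_of_cube hf hordS h30 h21 h12 h03 hfd hΦ₃ hΦ₃0 hbij₃).not_gt
  -- The shear x₁ ↦ x₁ − r x₂ with r = q/p turns x₂²(p x₁ + q x₂) into p x₁x₂².
  · set r : ℝ := taylorCoefficient f (0, 3) / taylorCoefficient f (1, 2) with hr
    let R : (ℝ × ℝ) ≃L[ℝ] (ℝ × ℝ) := LinearEquiv.toContinuousLinearEquiv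
      { toFun := fun p => (p.1 - r * p.2, p.2)
        invFun := fun p => (p.1 + r * p.2, p.2)
        map_add' := fun p q => by ext <;> simp; ring
        map_smul' := fun c p => by ext <;> simp; ring
        left_inv := fun p => by ext <;> simp
        right_inv := fun p => by ext <;> simp }
    obtain ⟨hordR, hpart⟩ := hordS.comp hf R.contDiff (map_zero R)
    have key : ∀ x y : ℝ, homogeneousPart (f ∘ R) 3 (x, y) =
        taylorCoefficient f (1, 2) * (x * y ^ 2) := fun x y => by
      have : fderiv ℝ R 0 (x, y) = (x - r * y, y) := by rw [R.fderiv]; rfl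
      rw [hpart, this, homogeneousPart_three, h30, h21, hr]
      field_simp
      ring
    simp only [homogeneousPart_three] at key
    have e30 : taylorCoefficient (f ∘ R) (3, 0) = 0 := by linear_combination key 1 0
    have e03 : taylorCoefficient (f ∘ R) (0, 3) = 0 := by linear_combination key 0 1
    have e12 : taylorCoefficient (f ∘ R) (1, 2) = taylorCoefficient f (1, 2) := by
      linear_combination (key 1 1 + key 1 (-1)) / 2 - e30
    have e21 : taylorCoefficient (f ∘ R) (2, 1) = 0 := by
      linear_combination (key 1 1 - key 1 (-1)) / 2 - e03
    obtain ⟨Φ₄, hΦ₄, hΦ₄0, hbij₄, hd₄⟩ := hna' (S.trans T) R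
    exact ⟨R.trans (S.trans T), exists_normalForm (l := 1) (hf.comp R.contDiff) le_rfl hordR
      (e12.trans_ne h12) (by
        intro i hi hi0
        interval_cases i
        exacts [e03, absurd rfl hi0, e21, e30]) (hlin (R.trans (S.trans T))) hΦ₄ hΦ₄0 hbij₄ hd₄⟩

/-! ### From germs to globally smooth representatives, and the conclusion -/

lemma IsLocalCoordinateChange.exists_contDiff {Φ : ℝ × ℝ → ℝ × ℝ}
    (h : IsLocalCoordinateChange Φ) : ∃ Ψ : ℝ × ℝ → ℝ × ℝ, ContDiff ℝ ∞ Ψ ∧ Ψ 0 = 0 ∧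
      Function.Bijective (fderiv ℝ Ψ 0) ∧ Φ =ᶠ[𝓝 0] Ψ := by
  obtain ⟨hs, h0, hb⟩ := h
  obtain ⟨Ψ, hΨ, hE⟩ := hs.exists_contDiff
  exact ⟨Ψ, hΨ, hE.self_of_nhds ▸ h0, by rwa [← hE.fderiv_eq], hE⟩

lemma isLocalCoordinateChange_continuousLinearEquiv (T : (ℝ × ℝ) ≃L[ℝ] (ℝ × ℝ)) :
    IsLocalCoordinateChange T :=
  ⟨.of_contDiff T.contDiff, map_zero T, by rw [T.fderiv]; exact T.bijective⟩

theorem proposition3p1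
    (φ : ℝ × ℝ → ℝ)
    (hsmooth : SmoothNearZero φ)
    (hzero : φ 0 = 0)
    (hgrad : fderiv ℝ φ 0 = 0)
    (hfinite : (taylorSupport φ).Nonempty)
    (hlin : linearHeight φ < 2)
    (hnotadapted : ¬ ∃ T : (ℝ × ℝ) ≃L[ℝ] (ℝ × ℝ), LinearCoordinatesAdapted φ T) :
    ∃ (T : (ℝ × ℝ) ≃L[ℝ] (ℝ × ℝ)) (b : ℝ × ℝ → ℝ) (ψ b₀ : ℝ → ℝ) (m : ℕ) (c : ℝ),
      SmoothNearZero b ∧ SmoothNearZero ψ ∧ SmoothNearZero b₀ ∧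
      (∀ᶠ x in 𝓝 (0 : ℝ × ℝ), φ (T x) = b x * (x.2 - ψ x.1) ^ 2 + b₀ x.1) ∧
      2 ≤ m ∧ c ≠ 0 ∧
      (fun s : ℝ => ψ s - c * s ^ m) =O[𝓝 0] (fun s : ℝ => s ^ (m + 1)) ∧
      ((b 0 ≠ 0 ∧ IsFlatOrHasOrderAtLeast b₀ (2 * m + 1)) ∨
        (b 0 = 0 ∧
          (∃ (b₁ : ℝ × ℝ → ℝ) (b₂ : ℝ → ℝ),
            SmoothNearZero b₁ ∧ SmoothNearZero b₂ ∧ b₁ 0 ≠ 0 ∧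
            ∀ᶠ x in 𝓝 (0 : ℝ × ℝ), b x = x.1 * b₁ x + x.2 ^ 2 * b₂ x.2) ∧
          IsFlatOrHasOrderAtLeast b₀ (2 * m + 2))) := by
  obtain ⟨f, hf, hφf⟩ := hsmooth.exists_contDiff
  have hcomp : ∀ {Φ : ℝ × ℝ → ℝ × ℝ}, ContinuousAt Φ 0 → Φ 0 = 0 → φ ∘ Φ =ᶠ[𝓝 0] f ∘ Φ := by
    intro Φ hΦ hΦ0
    have : Tendsto Φ (𝓝 0) (𝓝 0) := by rw [ContinuousAt, hΦ0] at hΦ; exact hΦ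
    exact this.eventually hφf
  have hT : ∀ T : (ℝ × ℝ) ≃L[ℝ] (ℝ × ℝ), φ ∘ T =ᶠ[𝓝 0] f ∘ T := fun T =>
    hcomp T.continuous.continuousAt (map_zero T)
  have hord : WeightedOrderGE 1 1 2 f := by
    have hd : HasFDerivAt f (0 : ℝ × ℝ →L[ℝ] ℝ) ((0 : ℝ), (0 : ℝ)) := by
      rw [← hgrad, hφf.fderiv_eq]
      exact (hf.differentiable (by simp) 0).hasFDerivAt
    intro i j hij
    rcases i with _ | i
    · rw [taylorCoefficient_zero_left]
      rcases j with _ | j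
      · exact (taylorCoeff_zero _).trans (hφf.self_of_nhds.symm.trans hzero)
      · obtain rfl : j = 0 := by omega
        exact (taylorCoeff_one _).trans (hd.comp_hasDerivAt (f := fun y : ℝ => ((0 : ℝ), y)) (0 : ℝ)
          ((hasDerivAt_const _ (0 : ℝ)).prodMk (hasDerivAt_id (0 : ℝ)))).deriv
    · obtain ⟨rfl, rfl⟩ : i = 0 ∧ j = 0 := by omega
      rw [taylorCoefficient_zero_right]
      exact (taylorCoeff_one _).trans (hd.comp_hasDerivAt (f := fun x : ℝ => (x, (0 : ℝ))) (0 : ℝ)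
        ((hasDerivAt_id (0 : ℝ)).prodMk (hasDerivAt_const _ (0 : ℝ)))).deriv
  obtain ⟨T, b, ψ, b₀, m, c, hb, hψ, hb₀, heq, h⟩ := exists_normalForm_linear hf hord
    (fun T => by
      rw [← newtonDistance_congr (hT T)]
      exact (le_iSup (fun T : (ℝ × ℝ) ≃L[ℝ] (ℝ × ℝ) => newtonDistance (φ ∘ T)) T).trans_lt hlin)
    (fun T => by
      have hle : newtonDistance (φ ∘ T) ≤ height φ :=
        le_iSup₂ (f := fun (Φ : ℝ × ℝ → ℝ × ℝ) (_ : IsLocalCoordinateChange Φ) =>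
          newtonDistance (φ ∘ Φ)) T (isLocalCoordinateChange_continuousLinearEquiv T)
      have hlt : newtonDistance (φ ∘ T) < height φ :=
        lt_of_le_of_ne hle fun h => hnotadapted ⟨T, h⟩
      rw [height] at hlt
      simp only [lt_iSup_iff] at hlt
      obtain ⟨Φ, hΦ, hlt⟩ := hlt
      obtain ⟨Ψ, hΨ, hΨ0, hΨb, hE⟩ := hΦ.exists_contDiff
      have h1 : φ ∘ Φ =ᶠ[𝓝 0] f ∘ Ψ := by
        filter_upwards [hE, hcomp hΨ.continuous.continuousAt hΨ0] with x hx hx'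
        rw [← hx', Function.comp_apply, Function.comp_apply, hx]
      -- A change Ψ better than T in the original coordinates becomes T⁻¹ ∘ Ψ when read in the
      -- coordinates given by T.
      have h2 : (f ∘ T) ∘ (T.symm ∘ Ψ) = f ∘ Ψ := by ext x; simp
      refine ⟨T.symm ∘ Ψ, T.symm.contDiff.comp hΨ, by simp [hΨ0], ?_, ?_⟩
      · rw [T.symm.comp_fderiv]
        exact T.symm.bijective.comp hΨb
      · rwa [h2, ← newtonDistance_congr h1, ← newtonDistance_congr (hT T)])
  refine ⟨T, b, ψ, b₀, m, c, hb, hψ, hb₀, ?_, h⟩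
  filter_upwards [heq, hT T] with x hx hx'
  rw [← hx]
  exact hx'
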